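/- Let $(\mathcal X_0,\mu_0)$, $(\mathcal X_1,\mu_1)$ be finite probability spaces with $N_0$, $N_1$ points, let $k_i:\mathcal X_i\times\mathcal X_i\to\mathbb R$ be symmetric, let $\Pi(\mu_0,\mu_1)$ be the set of couplings, and $$\mathsf{GW}_{2,q}(\mu_0,\mu_1)^2=\inf_{\pi\in\Pi(\mu_0,\mu_1)}J_q(\pi),\qquad J_q(\pi)=\iint\bigl|k_0^q(x,x')-k_1^q(y,y')\bigr|^2\,d\pi(x,y)\,d\pi(x',y').$$ Let $\mathcal K=\{x\in\mathbb R^{N_0N_1}:\mathrm Ax=b,\ x\ge 0\}$ be the polytope of coupling vectors (the rows of $\mathrm A$ are the marginal constraints), $\mathrm M=4\,(k_0^q)\otimes(k_1^q)$ and $\mathsf H(x)=-\sum_i x_i\log x_i$ (with $0\log 0=0$). Assume one of the following: (a) $q\ge 1$ is an integer and $k_0,k_1$ are both positive semidefinite or both negative semidefinite kernels; then put $\mathrm M'=\mathrm M$ and $c=0$; (b) $q=2$, the points of $\mathcal X_i$ lie in $\mathbb R^{d_i}$ and $k_i(x,x')=\|x-x'\|$; then, with $\bar x=x-\int z\,d\mu_0(z)$,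 $\bar y=y-\int z\,d\mu_1(z)$, put $\mathrm M'_{(x,y),(x',y')}=16\,\langle\bar x,\bar x'\rangle\langle\bar y,\bar y'\rangle$ and $c_{(x,y)}=-4\|\bar x\|^2\|\bar y\|^2$. Then $\mathrm M'=\mathrm B^{\intercal}\mathrm B$ for some $\mathrm B\in\mathbb R^{r\times N_0N_1}$ with $r\le N_0N_1$. For every $r$ and every $\mathrm B\in\mathbb R^{r\times N_0N_1}$ with $\mathrm M'=\mathrm B^{\intercal}\mathrm B$ there are constants $C_2,C_3>0$ such that, with $C_1,C_1'$ as defined below, the set $\operatorname{argmin}_{\mathcal K}\{-\frac12x^{\intercal}\mathrm Mx\}$ is nonempty and, for every $0<\varepsilon\le C_3$: 1. every solution $x_\varepsilon^\star$ of $\min_{x\in\mathcal K}\{-\frac12x^{\intercal}\mathrm Mx-\varepsilon\mathsf H(x)\}$ satisfies $$\operatorname{dist}\Bigl(x_\varepsilon^\star,\ \operatorname*{argmin}_{x\in\mathcal K}\bigl\{-\tfrac12x^{\intercal}\mathrm Mx\bigr\}\Bigr)\le C_1\exp(-C_2/\varepsilon);$$ 2. every minimizer $\pi_\varepsilon^\star$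 of $J_q(\pi)-\varepsilon\mathsf H(\pi)$ over $\Pi(\mu_0,\mu_1)$ satisfies $$0\le J_q(\pi_\varepsilon^\star)-\mathsf{GW}_{2,q}(\mu_0,\mu_1)^2\le C_1'\exp(-C_2/\varepsilon).$$ The constants are as follows. Let $R_1=\max_{\mathcal K}\|x\|_1$, $R_{\mathsf H}=\max_{x,x'\in\mathcal K}(\mathsf H(x)-\mathsf H(x'))$, and $$C_1=2R_1e^{(R_1+R_{\mathsf H})/R_1},\qquad C_1'=\max\{4R_1^2\|\mathrm M'\|_{\mathrm{op}},\,2\|c\|R_1\}\,e^{(R_1+R_{\mathsf H})/R_1}.$$ If $-\frac12x^{\intercal}\mathrm Mx$ is not constant on $\mathcal K$, then $$C_2=\frac{\Delta}{2R_1},\qquad C_3=\min\Bigl\{\frac{\alpha}{R_{\mathsf H}},\ \frac{\gamma^2}{8R_{\mathsf H}},\ \frac{\Delta}{R_1+R_{\mathsf H}}\Bigr\}.$$ Here $\mathcal V$ is the set of vertices of $\mathcal K$, $\mathcal C_v=\{u\in\mathbb R^r:(c-\mathrm B^{\intercal}u)^{\intercal}v\le(c-\mathrm B^{\intercal}u)^{\intercal}w\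 \ \forall w\in\mathcal V\}$, $g_0(u)=\frac12\|u\|^2+\min_{x\in\mathcal K}(c-\mathrm B^{\intercal}u)^{\intercal}x$, $\mathcal I^\star=\{v\in\mathcal V:\mathcal C_v\cap\operatorname{argmin}g_0\ne\emptyset\}$, $\alpha=\inf\{g_0(u):u\in\mathcal C_v,\ v\in\mathcal V\setminus\mathcal I^\star\}-\min g_0$, $\gamma_v=\operatorname{dist}(\mathrm Bv,\operatorname{bd}\mathcal C_v)$, $\gamma=\min_{v\in\mathcal I^\star}\gamma_v$, $\Delta=\min_{v\in\mathcal I^\star}\Delta_v$, $$\Delta_v=\min\Bigl\{\kappa_{c-\mathrm B^{\intercal}\mathrm Bv},\ \frac{\gamma_v}{2}\min_{w\in\mathcal V,\ \mathrm Bw\ne\mathrm Bv}\|\mathrm Bw-\mathrm Bv\|\Bigr\},$$ and $\kappa_a$ is the minimum of $a^{\intercal}v$ over the vertices that do not minimize $a^{\intercal}x$ over $\mathcal K$, minus $\min_{x\in\mathcal K}a^{\intercal}x$; infima over the empty set are $+\infty$. -/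

import Mathlib

open MeasureTheory
open scoped ENNReal Matrix Kronecker

noncomputable section

/-! ### Entropic Gromov–Wasserstein problems on finite spaces -/

section GromovWasserstein

variable {X₀ X₁ : Type*} [MeasurableSpace X₀] [MeasurableSpace X₁]

/-- The couplings of `μ₀` and `μ₁`. -/
def couplings (μ₀ : Measure X₀) (μ₁ : Measure X₁) : Set (Measure (X₀ × X₁)) :=
  {π | π.map Prod.fst = μ₀ ∧ π.map Prod.snd = μ₁}

/-- The `(p, q)`-alignment cost of a plan `π`. -/
def gwCost (k₀ : X₀ → X₀ → ℝ) (k₁ : X₁ → X₁ → ℝ) (p : ℝ) (q : ℕ) (π : Measure (X₀ × X₁)) : ℝ :=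
  ∫ z, ∫ z', |k₀ z.1 z'.1 ^ q - k₁ z.2 z'.2 ^ q| ^ p ∂π ∂π

/-- The `(p, q)`-Gromov–Wasserstein distance. -/
def gwDist (k₀ : X₀ → X₀ → ℝ) (k₁ : X₁ → X₁ → ℝ) (p : ℝ) (q : ℕ)
    (μ₀ : Measure X₀) (μ₁ : Measure X₁) : ℝ :=
  (sInf (gwCost k₀ k₁ p q '' couplings μ₀ μ₁)) ^ (1 / p)

/-- Shannon entropy of a plan on a finite product, with `0 log 0 = 0`. -/
def planEntropy [Fintype X₀] [Fintype X₁] (π : Measure (X₀ × X₁)) : ℝ :=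
  -∑ z : X₀ × X₁, π.real {z} * Real.log (π.real {z})

/-- `π` solves the entropic Gromov–Wasserstein problem with `p = 2` and parameter `ε`. -/
def IsEGWSolution [Fintype X₀] [Fintype X₁] (k₀ : X₀ → X₀ → ℝ) (k₁ : X₁ → X₁ → ℝ) (q : ℕ)
    (μ₀ : Measure X₀) (μ₁ : Measure X₁) (ε : ℝ) (π : Measure (X₀ × X₁)) : Prop :=
  π ∈ couplings μ₀ μ₁ ∧ ∀ π' ∈ couplings μ₀ μ₁,
    gwCost k₀ k₁ 2 q π - ε * planEntropy π ≤ gwCost k₀ k₁ 2 q π' - ε * planEntropy π'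

end GromovWasserstein

/-- Positive semidefinite kernels: all Gram matrices are positive semidefinite. -/
def IsPSDKernel {X : Type*} (k : X → X → ℝ) : Prop :=
  ∀ (s : ℕ) (x : Fin s → X), (Matrix.of fun l m => k (x l) (x m)).PosSemidef

/-- Negative semidefinite kernels. -/
def IsNSDKernel {X : Type*} (k : X → X → ℝ) : Prop :=
  ∀ (s : ℕ) (x : Fin s → X), (-(Matrix.of fun l m => k (x l) (x m))).PosSemidef

/-! ### The quadratic program of the Gromov–Wasserstein problem -/

section GWProgram

variable {X₀ X₁ : Type*} [Fintype X₀] [Fintype X₁]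

open Classical in
/-- The matrix of the marginal constraints. -/
def marginalMatrix (X₀ X₁ : Type*) : Matrix (X₀ ⊕ X₁) (X₀ × X₁) ℝ :=
  Matrix.of fun s z =>
    Sum.elim (fun i => if z.1 = i then 1 else 0) (fun j => if z.2 = j then 1 else 0) s

/-- The right-hand side of the marginal constraints. -/
def marginalVector [MeasurableSpace X₀] [MeasurableSpace X₁]
    (μ₀ : Measure X₀) (μ₁ : Measure X₁) : X₀ ⊕ X₁ → ℝ :=
  Sum.elim (fun i => μ₀.real {i}) (fun j => μ₁.real {j})

/-- The feasible set `{x : A x = b, x ≥ 0}`. -/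
def transportPolytope [MeasurableSpace X₀] [MeasurableSpace X₁]
    (μ₀ : Measure X₀) (μ₁ : Measure X₁) : Set (EuclideanSpace ℝ (X₀ × X₁)) :=
  {x | marginalMatrix X₀ X₁ *ᵥ x.ofLp = marginalVector μ₀ μ₁ ∧ ∀ z, 0 ≤ x z}

/-- The matrix `M = 4 (k₀^q) ⊗ (k₁^q)`. -/
def gwMatrix (k₀ : X₀ → X₀ → ℝ) (k₁ : X₁ → X₁ → ℝ) (q : ℕ) :
    Matrix (X₀ × X₁) (X₀ × X₁) ℝ :=
  (4 : ℝ) • ((Matrix.of fun i i' => k₀ i i' ^ q) ⊗ₖ (Matrix.of fun j j' => k₁ j j' ^ q))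

/-- The concave quadratic objective `-½ xᵀ M x`. -/
def concaveQuad {ι : Type*} [Fintype ι] (M : Matrix ι ι ℝ) (x : EuclideanSpace ℝ ι) : ℝ :=
  -(1 / 2) * (x.ofLp ⬝ᵥ (M *ᵥ x.ofLp))

/-- The points of `X` recentred so as to have `μ`-mean zero. -/
def centred {X : Type*} [MeasurableSpace X] {d : ℕ} (μ : Measure X)
    (ξ : X → EuclideanSpace ℝ (Fin d)) (x : X) : EuclideanSpace ℝ (Fin d) :=
  ξ x - ∫ x', ξ x' ∂μ

/-- The matrix whose rows are the vectors `4 z_{ij}`, `z_{ij}(x, y) = x_i y_j`. -/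
def euclideanFactor {d₀ d₁ : ℕ} (ξ₀ : X₀ → EuclideanSpace ℝ (Fin d₀))
    (ξ₁ : X₁ → EuclideanSpace ℝ (Fin d₁)) : Matrix (Fin d₀ × Fin d₁) (X₀ × X₁) ℝ :=
  Matrix.of fun ij z => 4 * (ξ₀ z.1 ij.1 * ξ₁ z.2 ij.2)

/-- The linear term `c(x, y) = -4 ‖x‖² ‖y‖²`. -/
def euclideanLinear {d₀ d₁ : ℕ} (ξ₀ : X₀ → EuclideanSpace ℝ (Fin d₀))
    (ξ₁ : X₁ → EuclideanSpace ℝ (Fin d₁)) : EuclideanSpace ℝ (X₀ × X₁) :=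
  WithLp.toLp 2 fun z => -4 * (‖ξ₀ z.1‖ ^ 2 * ‖ξ₁ z.2‖ ^ 2)

end GWProgram

/-! ### Constants of the program `min_{x ∈ K} -½ xᵀ Bᵀ B x + cᵀ x` -/

section Constants

/-- The set of minimizers of `f` over `K`. -/
def argminOn {E : Type*} (f : E → ℝ) (K : Set E) : Set E :=
  {x | x ∈ K ∧ ∀ y ∈ K, f x ≤ f y}

variable {ι ρ : Type*} [Fintype ι] [Fintype ρ]

/-- Entropy of a vector with nonnegative entries, with `0 log 0 = 0`. -/
def vecEntropy (x : EuclideanSpace ℝ ι) : ℝ := -∑ i, x i * Real.log (x i)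

/-- `R_H = max_{x, x' ∈ K} (H(x) - H(x'))`. -/
def entropyRadius (K : Set (EuclideanSpace ℝ ι)) : ℝ :=
  sSup {t | ∃ x ∈ K, ∃ x' ∈ K, t = vecEntropy x - vecEntropy x'}

/-- `R₁ = max_{x ∈ K} ‖x‖₁`. -/
def l1Radius (K : Set (EuclideanSpace ℝ ι)) : ℝ :=
  sSup ((fun x : EuclideanSpace ℝ ι => ∑ i, |x i|) '' K)

/-- The linear form `x ↦ aᵀ x`. -/
def linForm (a x : EuclideanSpace ℝ ι) : ℝ := a.ofLp ⬝ᵥ x.ofLp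

/-- The optimal value `min_{x ∈ K} aᵀ x`. -/
def lpValue (K : Set (EuclideanSpace ℝ ι)) (a : EuclideanSpace ℝ ι) : ℝ :=
  sInf (linForm a '' K)

/-- The suboptimality gap `κ_a` of the vertices of `K` (it is `⊤` if all vertices are optimal). -/
def lpGap (K : Set (EuclideanSpace ℝ ι)) (a : EuclideanSpace ℝ ι) : ℝ≥0∞ :=
  ⨅ v ∈ K.extremePoints ℝ \ argminOn (linForm a) K, ENNReal.ofReal (linForm a v - lpValue K a)

/-- The vector `B x`. -/
def matApply (B : Matrix ρ ι ℝ) (x : EuclideanSpace ℝ ι) : EuclideanSpace ℝ ρ :=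
  WithLp.toLp 2 (B *ᵥ x.ofLp)

/-- The cost vector `c - Bᵀ u`. -/
def tiltedCost (B : Matrix ρ ι ℝ) (c : EuclideanSpace ℝ ι) (u : EuclideanSpace ℝ ρ) :
    EuclideanSpace ℝ ι :=
  c - matApply Bᵀ u

/-- The set of those `u` for which `v` is at least as good as every vertex of `K` for the cost
`c - Bᵀ u`. -/
def cell (K : Set (EuclideanSpace ℝ ι)) (B : Matrix ρ ι ℝ) (c v : EuclideanSpace ℝ ι) :
    Set (EuclideanSpace ℝ ρ) :=
  {u | ∀ w ∈ K.extremePoints ℝ, linForm (tiltedCost B c u) v ≤ linForm (tiltedCost B c u) w}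

/-- `g₀(u) = ½ ‖u‖² + min_{x ∈ K} (c - Bᵀ u)ᵀ x`. -/
def gZero (K : Set (EuclideanSpace ℝ ι)) (B : Matrix ρ ι ℝ) (c : EuclideanSpace ℝ ι)
    (u : EuclideanSpace ℝ ρ) : ℝ :=
  1 / 2 * ‖u‖ ^ 2 + lpValue K (tiltedCost B c u)

/-- The vertices whose cell contains a global minimizer of `g₀`. -/
def optVertices (K : Set (EuclideanSpace ℝ ι)) (B : Matrix ρ ι ℝ) (c : EuclideanSpace ℝ ι) :
    Set (EuclideanSpace ℝ ι) :=
  {v | v ∈ K.extremePoints ℝ ∧ (cell K B c v ∩ argminOn (gZero K B c) Set.univ).Nonempty}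

/-- `α`: the gap between the minimum of `g₀` over the cells of the other vertices and its global
minimum. -/
def alphaConst (K : Set (EuclideanSpace ℝ ι)) (B : Matrix ρ ι ℝ) (c : EuclideanSpace ℝ ι) :
    ℝ≥0∞ :=
  ⨅ v ∈ K.extremePoints ℝ \ optVertices K B c, ⨅ u ∈ cell K B c v,
    ENNReal.ofReal (gZero K B c u - ⨅ u', gZero K B c u')

/-- `γ_v = dist(B v, bd C_v)`. -/
def gammaAt (K : Set (EuclideanSpace ℝ ι)) (B : Matrix ρ ι ℝ) (c v : EuclideanSpace ℝ ι) :
    ℝ≥0∞ :=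
  Metric.infEDist (matApply B v) (frontier (cell K B c v))

/-- `γ = min_v γ_v` over the optimal vertices. -/
def gammaConst (K : Set (EuclideanSpace ℝ ι)) (B : Matrix ρ ι ℝ) (c : EuclideanSpace ℝ ι) :
    ℝ≥0∞ :=
  ⨅ v ∈ optVertices K B c, gammaAt K B c v

/-- `Δ_v = min {κ_{c - BᵀBv}, (γ_v / 2) min_{w : Bw ≠ Bv} ‖Bw - Bv‖}`. -/
def deltaAt (K : Set (EuclideanSpace ℝ ι)) (B : Matrix ρ ι ℝ) (c v : EuclideanSpace ℝ ι) :
    ℝ≥0∞ :=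
  min (lpGap K (tiltedCost B c (matApply B v)))
    (gammaAt K B c v / 2 *
      ⨅ w ∈ {w | w ∈ K.extremePoints ℝ ∧ matApply B w ≠ matApply B v},
        ENNReal.ofReal ‖matApply B w - matApply B v‖)

/-- `Δ = min_v Δ_v` over the optimal vertices. -/
def deltaConst (K : Set (EuclideanSpace ℝ ι)) (B : Matrix ρ ι ℝ) (c : EuclideanSpace ℝ ι) :
    ℝ≥0∞ :=
  ⨅ v ∈ optVertices K B c, deltaAt K B c v

/-- `C₁ = 2 R₁ exp ((R₁ + R_H) / R₁)`. -/
def rateC1 (K : Set (EuclideanSpace ℝ ι)) : ℝ :=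
  2 * l1Radius K * Real.exp ((l1Radius K + entropyRadius K) / l1Radius K)

/-- `C₂ = Δ / (2 R₁)`. -/
def rateC2 (K : Set (EuclideanSpace ℝ ι)) (B : Matrix ρ ι ℝ) (c : EuclideanSpace ℝ ι) : ℝ≥0∞ :=
  deltaConst K B c / ENNReal.ofReal (2 * l1Radius K)

/-- `C₃ = min {α / R_H, γ² / (8 R_H), Δ / (R₁ + R_H)}`. -/
def rateC3 (K : Set (EuclideanSpace ℝ ι)) (B : Matrix ρ ι ℝ) (c : EuclideanSpace ℝ ι) : ℝ≥0∞ :=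
  min (alphaConst K B c / ENNReal.ofReal (entropyRadius K))
    (min (gammaConst K B c ^ 2 / ENNReal.ofReal (8 * entropyRadius K))
      (deltaConst K B c / ENNReal.ofReal (l1Radius K + entropyRadius K)))

open Classical in
/-- The operator norm of a matrix for the Euclidean norm. -/
def opNorm (M : Matrix ι ι ℝ) : ℝ := ‖Matrix.toEuclideanCLM (n := ι) (𝕜 := ℝ) M‖

/-- `C₁' = max {4 R₁² ‖M‖_op, 2 ‖c‖ R₁} exp ((R₁ + R_H) / R₁)`. -/
def rateC1' (K : Set (EuclideanSpace ℝ ι)) (M : Matrix ι ι ℝ) (c : EuclideanSpace ℝ ι) : ℝ :=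
  max (4 * l1Radius K ^ 2 * opNorm M) (2 * ‖c‖ * l1Radius K) *
    Real.exp ((l1Radius K + entropyRadius K) / l1Radius K)

end Constants

end

/-! ### Linear maps and linear forms on Euclidean space -/

section MatApply

variable {ι ρ : Type*} [Fintype ι]

/-! On couplings, `J_q` differs from `-½ xᵀMx` only by terms fixed by the marginals. In both cases
this agrees on `K`, up to a constant, with the concave function `f(x) = -½‖Bx‖² + cᵀx`. It remains
to study the entropic penalization of `f` on a polytope of probability vectors.

Completing the square, `f(x) + ½‖u - Bx‖² = ½‖u‖² + (c - Bᵀu)ᵀx` (`liftedObjective_eq`). For fixed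
`u` the right side is affine in `x`, majorizes `f`, and touches it where `Bx = u`. Hence an entropic
minimizer `x` also solves the entropic linear program with cost `c - Bᵀu`, `u = Bx`. The bound `ε
R_H ≤ α` puts this `u` in the cell of a vertex `v` minimizing `f`, and `8 ε R_H ≤ γ²` gives `‖u -
Bv‖ ≤ γ_v / 2`. There the optimal vertices of the linear program all minimize `f`, and its gap is at
least `Δ` (`linearized_near_optVertex`).

For an entropic linear program with gap `κ`, split `x = (1 - t)p + ts` with `p` in the hull of the
optimal vertices and `s` in the hull of the others. Comparing `x` with `p` gives `tκ ≤ εt(R_H + 1 -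
log t)`, so `t ≤ exp(1 + R_H) exp(-κ/ε)` (`exists_decomposition_entropic`). With `κ = Δ` the decay
is `exp(-Δ/ε)`; half of the exponent is spent on absorbing numerical factors, which leaves `C₂ =
Δ/2` since `R₁ = 1`. -/

lemma matApply_add (B : Matrix ρ ι ℝ) (x y : EuclideanSpace ℝ ι) :
    matApply B (x + y) = matApply B x + matApply B y := by
  simp [matApply, Matrix.mulVec_add]

lemma matApply_sub (B : Matrix ρ ι ℝ) (x y : EuclideanSpace ℝ ι) :
    matApply B (x - y) = matApply B x - matApply B y := by
  simp [matApply, Matrix.mulVec_sub]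

lemma matApply_smul (B : Matrix ρ ι ℝ) (t : ℝ) (x : EuclideanSpace ℝ ι) :
    matApply B (t • x) = t • matApply B x := by
  simp [matApply, Matrix.mulVec_smul]

lemma continuous_matApply (B : Matrix ρ ι ℝ) : Continuous (matApply B) := by
  unfold matApply; fun_prop

end MatApply

section LinearAlgebra

variable {ι ρ : Type*} [Fintype ι] [Fintype ρ]

lemma linForm_eq_inner (a x : EuclideanSpace ℝ ι) : linForm a x = inner ℝ a x := by
  rw [linForm, EuclideanSpace.inner_eq_star_dotProduct, star_trivial, dotProduct_comm]

lemma linForm_add (a x y : EuclideanSpace ℝ ι) :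
    linForm a (x + y) = linForm a x + linForm a y := by
  simp only [linForm_eq_inner, inner_add_right]

lemma linForm_smul (a x : EuclideanSpace ℝ ι) (t : ℝ) :
    linForm a (t • x) = t * linForm a x := by
  simp only [linForm_eq_inner, inner_smul_right]

lemma linForm_sub (a x y : EuclideanSpace ℝ ι) :
    linForm a (x - y) = linForm a x - linForm a y := by
  simp only [linForm_eq_inner, inner_sub_right]

lemma continuous_linForm (a : EuclideanSpace ℝ ι) : Continuous (linForm a) := by
  have : linForm a = fun x => inner ℝ a x := funext (linForm_eq_inner a)
  rw [this]; fun_prop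

lemma linForm_tiltedCost (B : Matrix ρ ι ℝ) (c x : EuclideanSpace ℝ ι)
    (u : EuclideanSpace ℝ ρ) :
    linForm (tiltedCost B c u) x = linForm c x - inner ℝ u (matApply B x) := by
  rw [linForm_eq_inner, linForm_eq_inner, tiltedCost, inner_sub_left]
  congr 1
  simp only [EuclideanSpace.inner_eq_star_dotProduct, matApply, star_trivial]
  rw [Matrix.dotProduct_mulVec, Matrix.vecMul_transpose]

end LinearAlgebra

noncomputable section

/-! ### The concave objective and its affine majorants -/

section Quadratic

variable {ι ρ : Type*} [Fintype ι] [Fintype ρ]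

/-- The concave quadratic objective `-½ ‖B x‖² + cᵀ x`. -/
def factoredQuad (B : Matrix ρ ι ℝ) (c x : EuclideanSpace ℝ ι) : ℝ :=
  -(1 / 2) * ‖matApply B x‖ ^ 2 + linForm c x

/-- The partially linearized objective `½ ‖u‖² + (c - Bᵀ u)ᵀ x`. -/
def liftedObjective (B : Matrix ρ ι ℝ) (c x : EuclideanSpace ℝ ι) (u : EuclideanSpace ℝ ρ) : ℝ :=
  1 / 2 * ‖u‖ ^ 2 + linForm (tiltedCost B c u) x

lemma liftedObjective_eq (B : Matrix ρ ι ℝ) (c x : EuclideanSpace ℝ ι)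
    (u : EuclideanSpace ℝ ρ) :
    liftedObjective B c x u = factoredQuad B c x + 1 / 2 * ‖u - matApply B x‖ ^ 2 := by
  rw [liftedObjective, factoredQuad, linForm_tiltedCost, norm_sub_sq_real]
  ring

lemma factoredQuad_le_liftedObjective (B : Matrix ρ ι ℝ) (c x : EuclideanSpace ℝ ι)
    (u : EuclideanSpace ℝ ρ) : factoredQuad B c x ≤ liftedObjective B c x u := by
  rw [liftedObjective_eq]
  have := sq_nonneg ‖u - matApply B x‖
  linarith

lemma liftedObjective_matApply (B : Matrix ρ ι ℝ) (c x : EuclideanSpace ℝ ι) :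
    liftedObjective B c x (matApply B x) = factoredQuad B c x := by
  simp [liftedObjective_eq]

lemma continuous_factoredQuad (B : Matrix ρ ι ℝ) (c : EuclideanSpace ℝ ι) :
    Continuous (factoredQuad B c) := by
  unfold factoredQuad
  have h1 := continuous_matApply B
  have h2 := continuous_linForm c
  fun_prop

end Quadratic

/-! ### Entropy along segments -/

section Entropy

variable {ι : Type*} [Fintype ι]

lemma vecEntropy_eq_sum (x : EuclideanSpace ℝ ι) : vecEntropy x = ∑ i, Real.negMulLog (x i) := by
  simp [vecEntropy, Real.negMulLog]

lemma continuous_vecEntropy : Continuous (vecEntropy : EuclideanSpace ℝ ι → ℝ) := by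
  have : (vecEntropy : EuclideanSpace ℝ ι → ℝ) = fun x => ∑ i, Real.negMulLog (x i) :=
    funext vecEntropy_eq_sum
  rw [this]
  have h := Real.continuous_negMulLog
  fun_prop

lemma negMulLog_add_le {a b : ℝ} (ha : 0 ≤ a) (hb : 0 ≤ b) :
    Real.negMulLog (a + b) ≤ Real.negMulLog a + Real.negMulLog b := by
  rcases ha.eq_or_lt with rfl | ha
  · simp
  rcases hb.eq_or_lt with rfl | hb
  · simp
  have h1 := Real.log_le_log ha (by linarith : a ≤ a + b)
  have h2 := Real.log_le_log hb (by linarith : b ≤ a + b)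
  simp only [Real.negMulLog]
  nlinarith

lemma negMulLog_one_sub_le {t : ℝ} (h1 : t ≤ 1) : Real.negMulLog (1 - t) ≤ t := by
  rcases h1.eq_or_lt with rfl | h1
  · simp
  have h := Real.one_sub_inv_le_log_of_pos (by linarith : 0 < 1 - t)
  have : (1 - t) * (1 - (1 - t)⁻¹) = -t := by
    have : 1 - t ≠ 0 := by linarith
    field_simp; ring
  have h' := mul_le_mul_of_nonneg_left h (by linarith : 0 ≤ 1 - t)
  simp only [Real.negMulLog]
  linarith

/-- If `x` vanishes at `i`, then moving towards `y` gains entropy with unbounded slope. -/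
lemma vecEntropy_mix_ge {x y : EuclideanSpace ℝ ι} (hx : ∀ i, 0 ≤ x i) (hy : ∀ i, 0 ≤ y i)
    {t : ℝ} (h0 : 0 ≤ t) (h1 : t ≤ 1) {i : ι} (hi : x i = 0) :
    (1 - t) * vecEntropy x + t * vecEntropy y + y i * Real.negMulLog t ≤
      vecEntropy ((1 - t) • x + t • y) := by
  classical
  simp only [vecEntropy_eq_sum, Finset.mul_sum]
  have hs : y i * Real.negMulLog t = ∑ j, if j = i then y i * Real.negMulLog t else 0 := by simp
  rw [hs, ← Finset.sum_add_distrib, ← Finset.sum_add_distrib]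
  refine Finset.sum_le_sum fun j _ => ?_
  split_ifs with hj
  -- At the vanishing coordinate the mixture is `t * y j`, and the product rule for `negMulLog`
  -- gives equality; the other coordinates use concavity.
  · subst hj
    simp [hi, Real.negMulLog_mul]
    linarith
  · rw [add_zero]
    exact Real.concaveOn_negMulLog.2 (hx j) (hy j) (by linarith) h0 (by ring)

/-- Subadditivity and the product rule for `negMulLog` apply in each coordinate; because both masses
are one, the errors add up to the binary entropy of `t`, whatever the dimension. -/
lemma vecEntropy_mix_le {x y : EuclideanSpace ℝ ι} (hx : ∀ i, 0 ≤ x i) (hy : ∀ i, 0 ≤ y i)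
    (hx1 : ∑ i, x i = 1) (hy1 : ∑ i, y i = 1) {t : ℝ} (h0 : 0 ≤ t) (h1 : t ≤ 1) :
    vecEntropy ((1 - t) • x + t • y) ≤
      (1 - t) * vecEntropy x + t * vecEntropy y + Real.negMulLog (1 - t) + Real.negMulLog t := by
  have key : ∀ i, Real.negMulLog (((1 - t) • x + t • y) i) ≤
      ((1 - t) * Real.negMulLog (x i) + t * Real.negMulLog (y i)) +
        x i * Real.negMulLog (1 - t) + y i * Real.negMulLog t := by
    intro i
    have := negMulLog_add_le (mul_nonneg (sub_nonneg.2 h1) (hx i)) (mul_nonneg h0 (hy i))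
    rw [Real.negMulLog_mul, Real.negMulLog_mul] at this
    simp only [PiLp.add_apply, PiLp.smul_apply, smul_eq_mul]
    linarith
  simp only [vecEntropy_eq_sum]
  refine (Finset.sum_le_sum fun i _ => key i).trans (le_of_eq ?_)
  simp only [Finset.sum_add_distrib, ← Finset.mul_sum, ← Finset.sum_mul, hx1, hy1]
  ring

end Entropy

lemma norm_le_one_of_sum_eq_one {ι : Type*} [Fintype ι] {x : EuclideanSpace ℝ ι}
    (h0 : ∀ i, 0 ≤ x i) (h1 : ∑ i, x i = 1) : ‖x‖ ≤ 1 := by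
  have h : ‖x‖ ^ 2 ≤ 1 := by
    rw [EuclideanSpace.real_norm_sq_eq, ← h1]
    refine Finset.sum_le_sum fun i _ => ?_
    have h2 : x i ≤ 1 := by
      rw [← h1]
      exact Finset.single_le_sum (fun j _ => h0 j) (Finset.mem_univ i)
    nlinarith [h0 i]
  nlinarith [norm_nonneg x]

/-! ### Polytopes of probability vectors and entropic linear programs -/

section Polytope

variable {ι ρ : Type*} [Fintype ι] [Fintype ρ]

/-- A compact convex set of probability vectors whose extreme points are determined by their
supports. -/
structure IsProbPolytope (K : Set (EuclideanSpace ℝ ι)) : Prop where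
  convex : Convex ℝ K
  compact : IsCompact K
  nonempty : K.Nonempty
  nonneg : ∀ x ∈ K, ∀ i, 0 ≤ x i
  sum_eq_one : ∀ x ∈ K, ∑ i, x i = 1
  eq_of_support : ∀ v ∈ K.extremePoints ℝ, ∀ w ∈ K, (∀ i, v i = 0 → w i = 0) → w = v

namespace IsProbPolytope

variable {K : Set (EuclideanSpace ℝ ι)}

/-- An extreme point is determined by its zero set, and there are finitely many zero sets. -/
lemma finite_extremePoints (hK : IsProbPolytope K) : (K.extremePoints ℝ).Finite := by
  refine Set.Finite.of_finite_image (f := fun v => {i | v i = 0}) (Set.toFinite _) ?_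
  intro v hv w hw h
  refine (hK.eq_of_support v hv w hw.1 fun i hi => ?_).symm
  have : i ∈ {i | v i = 0} := hi
  simpa [show {i | v i = 0} = {i | w i = 0} from h] using this

lemma extremePoints_nonempty (hK : IsProbPolytope K) : (K.extremePoints ℝ).Nonempty :=
  hK.compact.extremePoints_nonempty hK.nonempty

/-- Krein–Milman, where the closure is superfluous because the hull of a finite set is closed. -/
lemma convexHull_extremePoints (hK : IsProbPolytope K) :
    convexHull ℝ (K.extremePoints ℝ) = K := by
  have h := closure_convexHull_extremePoints hK.compact hK.convex
  rwa [(hK.finite_extremePoints.isClosed_convexHull ℝ).closure_eq] at h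

lemma mix_mem (hK : IsProbPolytope K) {x y : EuclideanSpace ℝ ι} (hx : x ∈ K) (hy : y ∈ K)
    {t : ℝ} (h0 : 0 ≤ t) (h1 : t ≤ 1) : (1 - t) • x + t • y ∈ K :=
  hK.convex hx hy (by linarith) h0 (by ring)

lemma l1Radius_eq (hK : IsProbPolytope K) : l1Radius K = 1 := by
  have : (fun x : EuclideanSpace ℝ ι => ∑ i, |x i|) '' K = {1} := by
    have h : ∀ x ∈ K, ∑ i, |x i| = 1 := fun x hx => by
      rw [← hK.sum_eq_one x hx]
      exact Finset.sum_congr rfl fun i _ => abs_of_nonneg (hK.nonneg x hx i)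
    ext t
    constructor
    · rintro ⟨x, hx, rfl⟩; exact h x hx
    · rintro rfl
      obtain ⟨x, hx⟩ := hK.nonempty
      exact ⟨x, hx, h x hx⟩
  rw [l1Radius, this, csSup_singleton]

lemma sub_le_entropyRadius (hK : IsProbPolytope K) {x y : EuclideanSpace ℝ ι} (hx : x ∈ K)
    (hy : y ∈ K) : vecEntropy x - vecEntropy y ≤ entropyRadius K := by
  have hc : BddAbove ((fun p : EuclideanSpace ℝ ι × EuclideanSpace ℝ ι =>
      vecEntropy p.1 - vecEntropy p.2) '' K ×ˢ K) :=
    ((hK.compact.prod hK.compact).image ((continuous_vecEntropy.comp continuous_fst).sub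
      (continuous_vecEntropy.comp continuous_snd))).bddAbove
  refine le_csSup (hc.mono ?_) ⟨x, hx, y, hy, rfl⟩
  rintro t ⟨x, hx, y, hy, rfl⟩
  exact ⟨(x, y), ⟨hx, hy⟩, rfl⟩

lemma entropyRadius_nonneg (hK : IsProbPolytope K) : 0 ≤ entropyRadius K := by
  obtain ⟨x, hx⟩ := hK.nonempty
  simpa using hK.sub_le_entropyRadius hx hx

lemma norm_le_one (hK : IsProbPolytope K) {x : EuclideanSpace ℝ ι} (hx : x ∈ K) : ‖x‖ ≤ 1 :=
  norm_le_one_of_sum_eq_one (hK.nonneg x hx) (hK.sum_eq_one x hx)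

/-- A linear form attains its minimum over the polytope at an extreme point. -/
lemma exists_extremePoint_argmin (hK : IsProbPolytope K) (a : EuclideanSpace ℝ ι) :
    ∃ v ∈ K.extremePoints ℝ, v ∈ argminOn (linForm a) K := by
  obtain ⟨v, hv, hmin⟩ := Set.exists_min_image _ (linForm a) hK.finite_extremePoints
    hK.extremePoints_nonempty
  refine ⟨v, hv, hv.1, fun y hy => ?_⟩
  rw [← hK.convexHull_extremePoints] at hy
  have hc : Convex ℝ {x | linForm a v ≤ linForm a x} := by
    intro x hx y hy s t hs ht hst
    simp only [Set.mem_ofPred_eq, linForm_add, linForm_smul] at *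
    calc linForm a v = s * linForm a v + t * linForm a v := by rw [← add_mul, hst, one_mul]
      _ ≤ _ := by gcongr
  exact convexHull_min hmin hc hy

lemma mem_argmin_linForm_iff (hK : IsProbPolytope K) {a v : EuclideanSpace ℝ ι} (hv : v ∈ K) :
    v ∈ argminOn (linForm a) K ↔ ∀ w ∈ K.extremePoints ℝ, linForm a v ≤ linForm a w := by
  refine ⟨fun h w hw => h.2 w hw.1, fun h => ⟨hv, fun y hy => ?_⟩⟩
  obtain ⟨w, hw, hw'⟩ := hK.exists_extremePoint_argmin a
  exact (h w hw).trans (hw'.2 y hy)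

end IsProbPolytope

lemma lpValue_eq_of_mem_argmin {K : Set (EuclideanSpace ℝ ι)} {a v : EuclideanSpace ℝ ι}
    (hv : v ∈ argminOn (linForm a) K) : lpValue K a = linForm a v :=
  IsLeast.csInf_eq ⟨⟨v, hv.1, rfl⟩, by rintro _ ⟨y, hy, rfl⟩; exact hv.2 y hy⟩

namespace IsProbPolytope

variable {K : Set (EuclideanSpace ℝ ι)}

/-- A point splits into an optimal part and a part on vertices that are suboptimal by `κ`. -/
lemma exists_decomposition (hK : IsProbPolytope K) {a v : EuclideanSpace ℝ ι}
    (hv : v ∈ K.extremePoints ℝ) (hva : v ∈ argminOn (linForm a) K) {κ : ℝ}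
    (hκ : ∀ w ∈ K.extremePoints ℝ, w ∉ argminOn (linForm a) K → κ ≤ linForm a w - linForm a v)
    {x : EuclideanSpace ℝ ι} (hx : x ∈ K) :
    ∃ p ∈ convexHull ℝ (K.extremePoints ℝ ∩ argminOn (linForm a) K), ∃ s ∈ K, ∃ t : ℝ,
      0 ≤ t ∧ t ≤ 1 ∧ x = (1 - t) • p + t • s ∧ t * κ ≤ linForm a x - linForm a v := by
  have hE : (K.extremePoints ℝ ∩ argminOn (linForm a) K) ∪
      (K.extremePoints ℝ \ argminOn (linForm a) K) = K.extremePoints ℝ :=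
    Set.inter_union_sdiff _ _
  have hx' := hx
  rw [← hK.convexHull_extremePoints, ← hE] at hx'
  rcases (K.extremePoints ℝ \ argminOn (linForm a) K).eq_empty_or_nonempty with h | h
  · rw [h, Set.union_empty] at hx'
    refine ⟨x, hx', x, hx, 0, le_rfl, zero_le_one, by simp, ?_⟩
    linarith [hva.2 x hx]
  · rw [convexHull_union (Set.nonempty_of_mem (Set.mem_inter hv hva)) h,
      mem_convexJoin] at hx'
    obtain ⟨p, hp, s, hs, hxs⟩ := hx'
    rw [segment_eq_image] at hxs
    obtain ⟨t, ⟨h0, h1⟩, rfl⟩ := hxs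
    have hsK : s ∈ K := by
      rw [← hK.convexHull_extremePoints]; exact convexHull_mono Set.sdiff_subset hs
    have hpK : p ∈ K := by
      rw [← hK.convexHull_extremePoints]; exact convexHull_mono Set.inter_subset_left hp
    refine ⟨p, hp, s, hsK, t, h0, h1, rfl, ?_⟩
    -- This half-space contains the suboptimal vertices, hence their hull and `s`.
    have hc : Convex ℝ {x | linForm a v + κ ≤ linForm a x} := by
      intro x hx y hy s t hs ht hst
      simp only [Set.mem_ofPred_eq, linForm_add, linForm_smul] at *
      calc linForm a v + κ = s * (linForm a v + κ) + t * (linForm a v + κ) := by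
            rw [← add_mul, hst, one_mul]
        _ ≤ _ := by gcongr
    have hsub : K.extremePoints ℝ \ argminOn (linForm a) K ⊆
        {x | linForm a v + κ ≤ linForm a x} := fun w hw => by
      have := hκ w hw.1 hw.2
      simp only [Set.mem_ofPred_eq]
      linarith
    have h2 : linForm a v + κ ≤ linForm a s := convexHull_min hsub hc hs
    have h3 := hva.2 p hpK
    rw [linForm_add, linForm_smul, linForm_smul]
    nlinarith

/-- The explicit bound on the weight of the suboptimal part of the solution of an entropically
penalized linear program. -/
lemma exists_decomposition_entropic (hK : IsProbPolytope K) {a v : EuclideanSpace ℝ ι}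
    (hv : v ∈ K.extremePoints ℝ) (hva : v ∈ argminOn (linForm a) K) {κ : ℝ}
    (hκ : ∀ w ∈ K.extremePoints ℝ, w ∉ argminOn (linForm a) K → κ ≤ linForm a w - linForm a v)
    {ε : ℝ} (hε : 0 < ε) {x : EuclideanSpace ℝ ι}
    (hx : x ∈ argminOn (fun x => linForm a x - ε * vecEntropy x) K) :
    ∃ p ∈ convexHull ℝ (K.extremePoints ℝ ∩ argminOn (linForm a) K), ∃ s ∈ K, ∃ t : ℝ,
      0 ≤ t ∧ x = (1 - t) • p + t • s ∧
        t ≤ Real.exp (1 + entropyRadius K) * Real.exp (-κ / ε) := by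
  obtain ⟨p, hp, s, hs, t, h0, h1, hxt, ht⟩ := hK.exists_decomposition hv hva hκ hx.1
  refine ⟨p, hp, s, hs, t, h0, hxt, ?_⟩
  rcases h0.eq_or_lt with rfl | h0'
  · positivity
  have hpK : p ∈ K := by
    rw [← hK.convexHull_extremePoints]; exact convexHull_mono Set.inter_subset_left hp
  have hpv : linForm a p = linForm a v := by
    -- The form is constant on the optimal face, so `p` has the optimal value and serves as the
    -- competitor of `x`.
    have hc : Convex ℝ {x | linForm a x = linForm a v} := by
      intro x hx y hy s t hs ht hst
      simp only [Set.mem_ofPred_eq, linForm_add, linForm_smul] at *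
      rw [hx, hy, ← add_mul, hst, one_mul]
    have hsub : K.extremePoints ℝ ∩ argminOn (linForm a) K ⊆ {x | linForm a x = linForm a v} :=
      fun w hw => le_antisymm (hw.2.2 v hv.1) (hva.2 w hw.1.1)
    exact convexHull_min hsub hc hp
  have h2 := hx.2 p hpK
  simp only at h2
  have h3 := vecEntropy_mix_le (hK.nonneg p hpK) (hK.nonneg s hs) (hK.sum_eq_one p hpK)
    (hK.sum_eq_one s hs) h0 h1
  rw [← hxt] at h3
  have h4 := hK.sub_le_entropyRadius hs hpK
  have h5 := negMulLog_one_sub_le h1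
  -- The entropy gain over `p` is at most `t * R_H` plus the binary entropy of `t`, whose part
  -- `negMulLog (1 - t)` is at most `t`.
  have h6 : t * κ ≤ ε * (t * (entropyRadius K + 1 - Real.log t)) := by
    have : vecEntropy x - vecEntropy p ≤ t * (entropyRadius K + 1 - Real.log t) := by
      have := mul_le_mul_of_nonneg_left h4 h0
      simp only [Real.negMulLog] at h3 h5
      linarith
    have := mul_le_mul_of_nonneg_left this hε.le
    linarith
  have h7 : κ ≤ ε * (entropyRadius K + 1 - Real.log t) := by
    refine le_of_mul_le_mul_left ?_ h0'
    linarith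
  have h8 : κ / ε ≤ entropyRadius K + 1 - Real.log t := by
    rw [div_le_iff₀ hε]; linarith
  rw [← Real.exp_add, ← Real.log_le_iff_le_exp h0', neg_div]
  linarith

/-- A minimizer of the entropic program has full support. -/
lemma support_of_argmin_entropic (hK : IsProbPolytope K) {a : EuclideanSpace ℝ ι}
    {ε : ℝ} (hε : 0 < ε) {x : EuclideanSpace ℝ ι}
    (hx : x ∈ argminOn (fun x => linForm a x - ε * vecEntropy x) K) {y : EuclideanSpace ℝ ι}
    (hy : y ∈ K) {i : ι} (hi : x i = 0) : y i = 0 := by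
  by_contra hne
  have hpos : 0 < y i := lt_of_le_of_ne (hK.nonneg y hy i) (Ne.symm hne)
  -- Moving a fraction `t` towards `y` changes the objective by at most `t * (D + ε * y i * log t)`.
  -- The choice of `t` makes the bracket at most `-1`, against minimality.
  set D := linForm a y - linForm a x - ε * (vecEntropy y - vecEntropy x) with hD
  set t := min 1 (Real.exp (-(|D| + 1) / (ε * y i))) with ht
  have h0 : 0 < t := lt_min one_pos (Real.exp_pos _)
  have h1 : t ≤ 1 := min_le_left _ _
  have hm := hx.2 _ (hK.mix_mem hx.1 hy h0.le h1)
  have hH := vecEntropy_mix_ge (hK.nonneg x hx.1) (hK.nonneg y hy) h0.le h1 hi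
  simp only [linForm_add, linForm_smul] at hm
  have hlog : Real.log t ≤ -(|D| + 1) / (ε * y i) := by
    rw [Real.log_le_iff_le_exp h0]; exact min_le_right _ _
  rw [le_div_iff₀ (by positivity)] at hlog
  have h2 := mul_le_mul_of_nonneg_left hH hε.le
  simp only [Real.negMulLog] at h2
  have h3 : 0 ≤ t * (D + ε * y i * Real.log t) := by
    rw [hD]; linarith
  have h4 : 0 ≤ D + ε * y i * Real.log t := nonneg_of_mul_nonneg_right h3 h0
  linarith [le_abs_self D]

end IsProbPolytope

end Polytope

end

noncomputable section

/-- The open ball is connected and misses the frontier, so it cannot meet both the interior and the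
complement; its centre is in `C`. -/
lemma closedBall_subset_of_le_infEDist_frontier {E : Type*} [NormedAddCommGroup E]
    [NormedSpace ℝ E] {C : Set E} (hC : IsClosed C) {y : E} (hy : y ∈ C) {r : ℝ} (hr : 0 < r)
    (h : ENNReal.ofReal r ≤ Metric.infEDist y (frontier C)) : Metric.closedBall y r ⊆ C := by
  have hdisj : ∀ z ∈ Metric.ball y r, z ∉ frontier C := by
    intro z hz hzC
    have h1 := h.trans (Metric.infEDist_le_edist_of_mem hzC)
    rw [edist_dist, ENNReal.ofReal_le_ofReal_iff dist_nonneg, dist_comm] at h1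
    exact absurd (Metric.mem_ball.1 hz) (not_lt.2 h1)
  have hcase : ∀ z ∈ Metric.ball y r, z ∈ C → z ∈ interior C := by
    intro z hz hzC
    by_contra hn
    exact hdisj z hz (by rw [hC.frontier_eq]; exact ⟨hzC, hn⟩)
  have hball : Metric.ball y r ⊆ interior C := by
    refine (convex_ball y r).isPreconnected.subset_left_of_subset_union isOpen_interior
      hC.isOpen_compl (Set.disjoint_compl_right_iff_subset.2 interior_subset) ?_ ?_
    · intro z hz
      by_cases hzC : z ∈ C
      · exact Or.inl (hcase z hz hzC)
      · exact Or.inr hzC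
    · have hm := Metric.mem_ball_self (x := y) hr
      exact ⟨y, hm, hcase y hm hy⟩
  rw [← closure_ball y hr.ne']
  exact closure_minimal (hball.trans interior_subset) hC

lemma Set.Finite.iInf_pos {α : Type*} {S : Set α} (hS : S.Finite) {f : α → ℝ≥0∞}
    (hf : ∀ a ∈ S, 0 < f a) : 0 < ⨅ a ∈ S, f a := by
  rcases S.eq_empty_or_nonempty with rfl | hne
  · simp
  · obtain ⟨a, ha, hmin⟩ := Set.exists_min_image S f hS hne
    exact (hf a ha).trans_le (le_iInf₂ hmin)

/-! ### Cells, optimal vertices and the localization of entropic minimizers -/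

section Cells

variable {ι ρ : Type*} [Fintype ι] [Fintype ρ]

lemma continuous_linForm_tiltedCost (B : Matrix ρ ι ℝ) (c x : EuclideanSpace ℝ ι) :
    Continuous fun u => linForm (tiltedCost B c u) x := by
  simp only [linForm_tiltedCost]
  fun_prop

lemma isClosed_cell (K : Set (EuclideanSpace ℝ ι)) (B : Matrix ρ ι ℝ)
    (c v : EuclideanSpace ℝ ι) : IsClosed (cell K B c v) := by
  have : cell K B c v = ⋂ w ∈ K.extremePoints ℝ,
      {u | linForm (tiltedCost B c u) v ≤ linForm (tiltedCost B c u) w} := by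
    ext u; simp [cell]
  rw [this]
  exact isClosed_biInter fun w _ =>
    isClosed_le (continuous_linForm_tiltedCost B c v) (continuous_linForm_tiltedCost B c w)

namespace IsProbPolytope

variable {K : Set (EuclideanSpace ℝ ι)} {B : Matrix ρ ι ℝ} {c : EuclideanSpace ℝ ι}

lemma mem_cell_iff (hK : IsProbPolytope K) {v : EuclideanSpace ℝ ι} (hv : v ∈ K)
    {u : EuclideanSpace ℝ ρ} :
    u ∈ cell K B c v ↔ v ∈ argminOn (linForm (tiltedCost B c u)) K :=
  (hK.mem_argmin_linForm_iff hv).symm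

lemma gZero_eq (hK : IsProbPolytope K) {v : EuclideanSpace ℝ ι} (hv : v ∈ K)
    {u : EuclideanSpace ℝ ρ} (hu : u ∈ cell K B c v) :
    gZero K B c u = liftedObjective B c v u := by
  rw [gZero, liftedObjective, lpValue_eq_of_mem_argmin ((hK.mem_cell_iff hv).1 hu)]

lemma exists_mem_cell (hK : IsProbPolytope K) (B : Matrix ρ ι ℝ) (c : EuclideanSpace ℝ ι)
    (u : EuclideanSpace ℝ ρ) : ∃ v ∈ K.extremePoints ℝ, u ∈ cell K B c v := by
  obtain ⟨v, hv, hmin⟩ := hK.exists_extremePoint_argmin (tiltedCost B c u)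
  exact ⟨v, hv, (hK.mem_cell_iff hv.1).2 hmin⟩

/-- The affine majorant touching the objective at a minimizer is itself minimized at a vertex, which
is then at least as good. -/
lemma exists_extremePoint_argmin_factoredQuad (hK : IsProbPolytope K) (B : Matrix ρ ι ℝ)
    (c : EuclideanSpace ℝ ι) : ∃ v ∈ K.extremePoints ℝ, v ∈ argminOn (factoredQuad B c) K := by
  obtain ⟨x, hx, hmin⟩ := hK.compact.exists_isMinOn hK.nonempty
    (continuous_factoredQuad B c).continuousOn
  obtain ⟨v, hv, hvm⟩ := hK.exists_extremePoint_argmin (tiltedCost B c (matApply B x))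
  refine ⟨v, hv, hv.1, fun y hy => le_trans ?_ (hmin hy)⟩
  refine (factoredQuad_le_liftedObjective B c v (matApply B x)).trans ?_
  rw [← liftedObjective_matApply]
  have := hvm.2 x hx
  simp only [liftedObjective]
  linarith

/-- The majorant with `u = Bv` lies above the objective and agrees with it at `v`. -/
lemma argmin_factoredQuad_linearized {v : EuclideanSpace ℝ ι}
    (hv : v ∈ argminOn (factoredQuad B c) K) :
    v ∈ argminOn (linForm (tiltedCost B c (matApply B v))) K := by
  refine ⟨hv.1, fun y hy => ?_⟩
  have h := (hv.2 y hy).trans (factoredQuad_le_liftedObjective B c y (matApply B v))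
  rw [← liftedObjective_matApply] at h
  simp only [liftedObjective] at h
  linarith

lemma matApply_mem_cell (hK : IsProbPolytope K) {v : EuclideanSpace ℝ ι}
    (hv : v ∈ argminOn (factoredQuad B c) K) : matApply B v ∈ cell K B c v :=
  (hK.mem_cell_iff hv.1).2 (argmin_factoredQuad_linearized hv)

lemma gZero_matApply (hK : IsProbPolytope K) {v : EuclideanSpace ℝ ι}
    (hv : v ∈ argminOn (factoredQuad B c) K) :
    gZero K B c (matApply B v) = factoredQuad B c v := by
  rw [hK.gZero_eq hv.1 (hK.matApply_mem_cell hv), liftedObjective_matApply]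

lemma factoredQuad_le_gZero (hK : IsProbPolytope K) {v : EuclideanSpace ℝ ι}
    (hv : v ∈ argminOn (factoredQuad B c) K) (u : EuclideanSpace ℝ ρ) :
    factoredQuad B c v ≤ gZero K B c u := by
  obtain ⟨w, hw, hu⟩ := hK.exists_mem_cell B c u
  rw [hK.gZero_eq hw.1 hu]
  exact (hv.2 w hw.1).trans (factoredQuad_le_liftedObjective B c w u)

lemma iInf_gZero (hK : IsProbPolytope K) {v : EuclideanSpace ℝ ι}
    (hv : v ∈ argminOn (factoredQuad B c) K) : ⨅ u, gZero K B c u = factoredQuad B c v := by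
  refine le_antisymm ?_ (le_ciInf (hK.factoredQuad_le_gZero hv))
  rw [← hK.gZero_matApply hv]
  exact ciInf_le ⟨_, by rintro _ ⟨u, rfl⟩; exact hK.factoredQuad_le_gZero hv u⟩ _

/-- The optimal vertices are exactly the vertices minimizing the quadratic objective. -/
lemma mem_optVertices_iff (hK : IsProbPolytope K) {v : EuclideanSpace ℝ ι} :
    v ∈ optVertices K B c ↔ v ∈ K.extremePoints ℝ ∧ v ∈ argminOn (factoredQuad B c) K := by
  constructor
  · rintro ⟨hv, u, hu, hmin⟩
    obtain ⟨w, hw, hwm⟩ := hK.exists_extremePoint_argmin_factoredQuad B c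
    refine ⟨hv, hv.1, fun y hy => ?_⟩
    have h1 := hmin.2 (matApply B w) (Set.mem_univ _)
    rw [hK.gZero_matApply hwm, hK.gZero_eq hv.1 hu] at h1
    exact (factoredQuad_le_liftedObjective B c v u).trans (h1.trans (hwm.2 y hy))
  · rintro ⟨hv, hvm⟩
    refine ⟨hv, matApply B v, hK.matApply_mem_cell hvm, Set.mem_univ _, fun u _ => ?_⟩
    rw [hK.gZero_matApply hvm]
    exact hK.factoredQuad_le_gZero hvm u

/-- The majorant at `w` exceeds the objective by `½‖Bv - Bw‖²`, which is where strictness comes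
from. -/
lemma linForm_lt_of_matApply_ne {v : EuclideanSpace ℝ ι}
    (hv : v ∈ argminOn (factoredQuad B c) K) {w : EuclideanSpace ℝ ι} (hw : w ∈ K)
    (hne : matApply B w ≠ matApply B v) :
    linForm (tiltedCost B c (matApply B v)) v < linForm (tiltedCost B c (matApply B v)) w := by
  have h1 := hv.2 w hw
  have h2 := liftedObjective_eq B c w (matApply B v)
  have h3 : 0 < ‖matApply B v - matApply B w‖ ^ 2 := by
    have := norm_pos_iff.2 (sub_ne_zero.2 hne.symm)
    positivity
  rw [← liftedObjective_matApply B c v] at h1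
  simp only [liftedObjective] at h1 h2
  linarith

/-- Only `Bw - Bv` is paired with `u`: points with the same image under `B` compare in the same way
for every `u`. -/
lemma linForm_tiltedCost_sub (B : Matrix ρ ι ℝ) (c v w : EuclideanSpace ℝ ι)
    (u : EuclideanSpace ℝ ρ) :
    linForm (tiltedCost B c u) w - linForm (tiltedCost B c u) v =
      linForm c w - linForm c v - inner ℝ u (matApply B w - matApply B v) := by
  rw [linForm_tiltedCost, linForm_tiltedCost, inner_sub_right]
  ring

/-- Of the finitely many inequalities defining the cell, those with `Bw = Bv` do not depend on `u`,
and the others are strict at `Bv`. -/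
lemma matApply_mem_interior_cell (hK : IsProbPolytope K) {v : EuclideanSpace ℝ ι}
    (hv : v ∈ argminOn (factoredQuad B c) K) :
    matApply B v ∈ interior (cell K B c v) := by
  rw [mem_interior_iff_mem_nhds]
  have : cell K B c v = ⋂ w ∈ K.extremePoints ℝ,
      {u | linForm (tiltedCost B c u) v ≤ linForm (tiltedCost B c u) w} := by
    ext u; simp [cell]
  rw [this, Filter.biInter_mem hK.finite_extremePoints]
  intro w hw
  by_cases hne : matApply B w = matApply B v
  · refine Filter.univ_mem' fun u => ?_
    have h1 := linForm_tiltedCost_sub B c v w u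
    have h2 := linForm_tiltedCost_sub B c v w (matApply B v)
    have h3 := (argmin_factoredQuad_linearized hv).2 w hw.1
    simp only [hne, sub_self, inner_zero_right, sub_zero] at h1 h2
    simp only [Set.mem_ofPred_eq]
    linarith
  · filter_upwards [(isOpen_lt (continuous_linForm_tiltedCost B c v)
      (continuous_linForm_tiltedCost B c w)).mem_nhds (linForm_lt_of_matApply_ne hv hw.1 hne)]
      with u hu
    exact le_of_lt hu

lemma gammaAt_pos (hK : IsProbPolytope K) {v : EuclideanSpace ℝ ι}
    (hv : v ∈ argminOn (factoredQuad B c) K) : 0 < gammaAt K B c v := by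
  rw [gammaAt, Metric.infEDist_pos_iff_notMem_closure, isClosed_frontier.closure_eq]
  exact fun h => h.2 (hK.matApply_mem_interior_cell hv)

lemma gammaAt_ne_top (hK : IsProbPolytope K) {v : EuclideanSpace ℝ ι}
    (hv : v ∈ argminOn (factoredQuad B c) K) {w : EuclideanSpace ℝ ι}
    (hw : w ∈ K.extremePoints ℝ) (hne : matApply B w ≠ matApply B v) :
    gammaAt K B c v ≠ ⊤ := by
  refine Metric.infEDist_ne_top (nonempty_frontier_iff.2 ⟨⟨_, hK.matApply_mem_cell hv⟩, ?_⟩)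
  intro huniv
  set d := matApply B w - matApply B v with hd
  have hd0 : 0 < ‖d‖ ^ 2 := by
    have := norm_pos_iff.2 (sub_ne_zero.2 hne)
    positivity
  -- At `u = s • d`, `w` beats `v` by exactly one, so the cell is not the whole space and has a
  -- frontier.
  set s := (linForm c w - linForm c v + 1) / ‖d‖ ^ 2 with hs
  have hmem : s • d ∈ cell K B c v := huniv ▸ Set.mem_univ _
  have h1 := hmem w hw
  have h2 := linForm_tiltedCost_sub B c v w (s • d)
  rw [← hd, real_inner_smul_left, real_inner_self_eq_norm_sq, hs, div_mul_cancel₀ _ hd0.ne'] at h2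
  linarith

/-- Inside half of the inradius the strict inequalities defining the cell are quantitative. -/
lemma gammaAt_mul_le (hK : IsProbPolytope K) {v : EuclideanSpace ℝ ι}
    (hv : v ∈ argminOn (factoredQuad B c) K) {w : EuclideanSpace ℝ ι}
    (hw : w ∈ K.extremePoints ℝ) (hne : matApply B w ≠ matApply B v)
    {u : EuclideanSpace ℝ ρ} (hu : ENNReal.ofReal (2 * ‖u - matApply B v‖) ≤ gammaAt K B c v) :
    (gammaAt K B c v).toReal / 2 * ‖matApply B w - matApply B v‖ ≤
      linForm (tiltedCost B c u) w - linForm (tiltedCost B c u) v := by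
  have htop := hK.gammaAt_ne_top hv hw hne
  set g := (gammaAt K B c v).toReal with hg
  have hg0 : 0 < g := ENNReal.toReal_pos (hK.gammaAt_pos hv).ne' htop
  have hu' : 2 * ‖u - matApply B v‖ ≤ g := (ENNReal.ofReal_le_iff_le_toReal htop).1 hu
  have hsub := closedBall_subset_of_le_infEDist_frontier (isClosed_cell K B c v)
    (hK.matApply_mem_cell hv) hg0 (ENNReal.ofReal_toReal_le)
  set d := matApply B w - matApply B v with hd
  have hd0 : 0 < ‖d‖ := norm_pos_iff.2 (sub_ne_zero.2 hne)
  -- A further step of length `g / 2` towards `w` stays within `g` of `Bv`, hence in the cell, yet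
  -- lowers the margin by `g / 2 * ‖d‖`; the margin at `u` was at least that.
  have hmem : u + (g / 2 / ‖d‖) • d ∈ cell K B c v := by
    refine hsub ?_
    rw [mem_closedBall_iff_norm, add_sub_right_comm]
    refine (norm_add_le _ _).trans ?_
    rw [norm_smul, Real.norm_of_nonneg (by positivity), div_mul_cancel₀ _ hd0.ne']
    linarith
  have h1 := hmem w hw
  have h2 := linForm_tiltedCost_sub B c v w (u + (g / 2 / ‖d‖) • d)
  have h3 := linForm_tiltedCost_sub B c v w u
  have h4 : g / 2 / ‖d‖ * ‖d‖ ^ 2 = g / 2 * ‖d‖ := by field_simp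
  rw [← hd, inner_add_left, real_inner_smul_left, real_inner_self_eq_norm_sq, h4] at h2
  rw [← hd] at h3
  linarith

/-- Near `B v` for an optimal vertex `v`, the linearized program has the optimal vertices
`{w : B w = B v, cᵀ w = cᵀ v}` and gap at least `Δ_v`. -/
lemma linearized_near_optVertex (hK : IsProbPolytope K) {v : EuclideanSpace ℝ ι}
    (hve : v ∈ K.extremePoints ℝ) (hv : v ∈ argminOn (factoredQuad B c) K)
    {u : EuclideanSpace ℝ ρ} (hu : ENNReal.ofReal (2 * ‖u - matApply B v‖) ≤ gammaAt K B c v)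
    {D : ℝ} (hD : ENNReal.ofReal D ≤ deltaAt K B c v) :
    v ∈ argminOn (linForm (tiltedCost B c u)) K ∧
      (∀ w ∈ K.extremePoints ℝ, w ∈ argminOn (linForm (tiltedCost B c u)) K →
        matApply B w = matApply B v ∧ linForm c w = linForm c v) ∧
      ∀ w ∈ K.extremePoints ℝ, w ∉ argminOn (linForm (tiltedCost B c u)) K →
        D ≤ linForm (tiltedCost B c u) w - linForm (tiltedCost B c u) v := by
  have hfar : ∀ w ∈ K.extremePoints ℝ, matApply B w ≠ matApply B v →
      0 < linForm (tiltedCost B c u) w - linForm (tiltedCost B c u) v := by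
    intro w hw hne
    refine lt_of_lt_of_le ?_ (hK.gammaAt_mul_le hv hw hne hu)
    have h1 := ENNReal.toReal_pos (hK.gammaAt_pos hv).ne' (hK.gammaAt_ne_top hv hw hne)
    have h2 := norm_pos_iff.2 (sub_ne_zero.2 hne)
    positivity
  have hnear : ∀ w, matApply B w = matApply B v → ∀ u' : EuclideanSpace ℝ ρ,
      linForm (tiltedCost B c u') w - linForm (tiltedCost B c u') v =
        linForm c w - linForm c v := by
    intro w hw u'
    rw [linForm_tiltedCost_sub, hw, sub_self, inner_zero_right, sub_zero]
  have hvB := argmin_factoredQuad_linearized hv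
  have hopt : v ∈ argminOn (linForm (tiltedCost B c u)) K := by
    refine (hK.mem_argmin_linForm_iff hve.1).2 fun w hw => ?_
    by_cases hne : matApply B w = matApply B v
    · have h1 := hnear w hne u
      have h2 := hnear w hne (matApply B v)
      linarith [hvB.2 w hw.1]
    · linarith [hfar w hw hne]
  refine ⟨hopt, fun w hw hwm => ?_, fun w hw hwm => ?_⟩
  · have h0 := hwm.2 v hve.1
    by_cases hne : matApply B w = matApply B v
    · exact ⟨hne, by linarith [hnear w hne u, hopt.2 w hw.1]⟩
    · linarith [hfar w hw hne]
  · by_cases hne : matApply B w = matApply B v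
    · have hlt : linForm (tiltedCost B c u) v < linForm (tiltedCost B c u) w := by
        by_contra hle
        exact hwm ⟨hw.1, fun y hy => (not_lt.1 hle).trans (hopt.2 y hy)⟩
      have h1 := hnear w hne u
      have h2 := hnear w hne (matApply B v)
      -- The gap between `w` and `v` is the same at `u` and at `Bv`, so `κ` at `Bv` bounds it.
      have hwB : w ∉ argminOn (linForm (tiltedCost B c (matApply B v))) K := fun h => by
        linarith [h.2 v hve.1]
      have h3 := (hD.trans (min_le_left _ _)).trans (iInf₂_le w ⟨hw, hwB⟩)
      rw [lpValue_eq_of_mem_argmin hvB, ENNReal.ofReal_le_ofReal_iff (by linarith)] at h3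
      linarith
    · refine le_trans ?_ (hK.gammaAt_mul_le hv hw hne hu)
      have h3 := hD.trans (min_le_right _ _)
      have h4 : (⨅ w ∈ {w | w ∈ K.extremePoints ℝ ∧ matApply B w ≠ matApply B v},
          ENNReal.ofReal ‖matApply B w - matApply B v‖) ≤
          ENNReal.ofReal ‖matApply B w - matApply B v‖ := iInf₂_le w ⟨hw, hne⟩
      have h5 := h3.trans (mul_le_mul_right h4 _)
      have htop := hK.gammaAt_ne_top hv hw hne
      rw [ENNReal.ofReal_le_iff_le_toReal (ENNReal.mul_ne_top
        (ENNReal.div_ne_top htop (by simp)) ENNReal.ofReal_ne_top)] at h5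
      simpa [ENNReal.toReal_mul, ENNReal.toReal_div] using h5

/-- Otherwise a vertex would maximize entropy; maximizers have full support relative to `K`, and a
vertex with full support is the only point of `K`. -/
lemma entropyRadius_pos (hK : IsProbPolytope K) (hnt : K.Nontrivial) : 0 < entropyRadius K := by
  obtain ⟨v, hv⟩ := hK.extremePoints_nonempty
  obtain ⟨y, hy, hne⟩ := hnt.exists_ne v
  by_contra hle
  have hmin : v ∈ argminOn (fun x => linForm 0 x - 1 * vecEntropy x) K := by
    refine ⟨hv.1, fun x hx => ?_⟩
    have := hK.sub_le_entropyRadius hx hv.1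
    simp only [linForm_eq_inner, inner_zero_left]
    linarith
  exact hne (hK.eq_of_support v hv y hy fun i hi =>
    hK.support_of_argmin_entropic one_pos hmin hy hi)

lemma argmin_entropic_linearized {ε : ℝ} {x : EuclideanSpace ℝ ι}
    (hx : x ∈ argminOn (fun x => factoredQuad B c x - ε * vecEntropy x) K) :
    x ∈ argminOn (fun y => linForm (tiltedCost B c (matApply B x)) y - ε * vecEntropy y) K := by
  refine ⟨hx.1, fun y hy => ?_⟩
  have h1 := hx.2 y hy
  have h2 := factoredQuad_le_liftedObjective B c y (matApply B x)
  simp only [← liftedObjective_matApply B c x] at h1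
  simp only [liftedObjective] at h1 h2
  linarith

/-- The value of the entropic solution is strictly within `ε R_H` of the optimum. -/
lemma factoredQuad_entropic_lt (hK : IsProbPolytope K) (hnt : K.Nontrivial) {ε : ℝ} (hε : 0 < ε)
    {x : EuclideanSpace ℝ ι}
    (hx : x ∈ argminOn (fun x => factoredQuad B c x - ε * vecEntropy x) K)
    {v : EuclideanSpace ℝ ι} (hve : v ∈ K.extremePoints ℝ) :
    factoredQuad B c x < factoredQuad B c v + ε * entropyRadius K := by
  -- Strict because a vertex lacks full support and is no entropic minimizer. Strictness is what
  -- allows equality in `ε ≤ α / R_H`.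
  have hlt : factoredQuad B c x - ε * vecEntropy x < factoredQuad B c v - ε * vecEntropy v := by
    by_contra hle
    have hmin : v ∈ argminOn (fun x => factoredQuad B c x - ε * vecEntropy x) K :=
      ⟨hve.1, fun y hy => (not_lt.1 hle).trans (hx.2 y hy)⟩
    obtain ⟨y, hy, hne⟩ := hnt.exists_ne v
    exact hne (hK.eq_of_support v hve y hy fun i hi =>
      hK.support_of_argmin_entropic hε (argmin_entropic_linearized hmin) hy hi)
  have := mul_le_mul_of_nonneg_left (hK.sub_le_entropyRadius hx.1 hve.1) hε.le
  linarith

/-- Exponential convergence of the entropic solutions in terms of a decomposition into an optimal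
point and a remainder of exponentially small weight. -/
theorem exists_decomposition_quadratic (hK : IsProbPolytope K) (hnt : K.Nontrivial) {ε : ℝ}
    (hε : 0 < ε)
    (hα : ENNReal.ofReal ε ≤ alphaConst K B c / ENNReal.ofReal (entropyRadius K))
    (hγ : ENNReal.ofReal ε ≤ gammaConst K B c ^ 2 / ENNReal.ofReal (8 * entropyRadius K))
    {D : ℝ} (hD : ENNReal.ofReal D ≤ deltaConst K B c) {x : EuclideanSpace ℝ ι}
    (hx : x ∈ argminOn (fun x => factoredQuad B c x - ε * vecEntropy x) K) :
    ∃ p ∈ argminOn (factoredQuad B c) K, ∃ s ∈ K, ∃ t : ℝ, 0 ≤ t ∧ x = (1 - t) • p + t • s ∧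
      t ≤ Real.exp (1 + entropyRadius K) * Real.exp (-D / ε) := by
  have hR := hK.entropyRadius_pos hnt
  set u := matApply B x with hu
  obtain ⟨v₀, hv₀, hv₀m⟩ := hK.exists_extremePoint_argmin_factoredQuad B c
  obtain ⟨v, hve, huv⟩ := hK.exists_mem_cell B c u
  have hg : gZero K B c u < factoredQuad B c v₀ + ε * entropyRadius K := by
    refine lt_of_le_of_lt ?_ (hK.factoredQuad_entropic_lt hnt hε hx hv₀)
    rw [hK.gZero_eq hve.1 huv, ← liftedObjective_matApply]
    have := ((hK.mem_cell_iff hve.1).1 huv).2 x hx.1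
    simp only [liftedObjective, ← hu]
    linarith
  -- Otherwise `α ≤ g₀(u) - min g₀ < ε R_H ≤ α`.
  have hvopt : v ∈ optVertices K B c := by
    by_contra hn
    have h1 : alphaConst K B c ≤ ENNReal.ofReal (gZero K B c u - ⨅ u', gZero K B c u') :=
      (iInf₂_le v ⟨hve, hn⟩).trans (iInf₂_le u huv)
    have h2 := (ENNReal.mul_le_of_le_div hα).trans h1
    rw [← ENNReal.ofReal_mul hε.le, hK.iInf_gZero hv₀m, ENNReal.ofReal_le_ofReal_iff
      (sub_nonneg.2 (hK.factoredQuad_le_gZero hv₀m u))] at h2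
    linarith
  have hvm := (hK.mem_optVertices_iff.1 hvopt).2
  have hdist : ENNReal.ofReal (2 * ‖u - matApply B v‖) ≤ gammaAt K B c v := by
    have h1 : gammaConst K B c ≤ gammaAt K B c v := iInf₂_le v hvopt
    have h2 := ENNReal.mul_le_of_le_div hγ
    rw [← ENNReal.ofReal_mul hε.le] at h2
    -- On the cell `½‖u - Bv‖² = g₀(u) - f(v) < ε R_H`; multiplying by 8 explains that factor in
    -- `C₃`.
    have h3 : (2 * ‖u - matApply B v‖) ^ 2 ≤ ε * (8 * entropyRadius K) := by
      rw [hK.gZero_eq hve.1 huv, liftedObjective_eq] at hg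
      have := hvm.2 v₀ hv₀m.1
      have := hv₀m.2 v hve.1
      linarith
    have h4 : ENNReal.ofReal (2 * ‖u - matApply B v‖) ^ 2 ≤ gammaAt K B c v ^ 2 := by
      rw [← ENNReal.ofReal_pow (by positivity)]
      exact ((ENNReal.ofReal_le_ofReal h3).trans h2).trans (by gcongr)
    exact (ENNReal.pow_le_pow_left_iff two_ne_zero).1 h4
  obtain ⟨hopt, hface, hgap⟩ := hK.linearized_near_optVertex hve hvm hdist
    (hD.trans (iInf₂_le v hvopt))
  obtain ⟨p, hp, s, hs, t, h0, hxt, ht⟩ := hK.exists_decomposition_entropic hve hopt hgap hε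
    (argmin_entropic_linearized hx)
  refine ⟨p, ?_, s, hs, t, h0, hxt, ht⟩
  have hpK : p ∈ K := by
    rw [← hK.convexHull_extremePoints]; exact convexHull_mono Set.inter_subset_left hp
  -- Concavity alone would not make a mixture of minimizers optimal; sharing `Bv` and `cᵀv` does.
  have hconv : Convex ℝ {x | matApply B x = matApply B v ∧ linForm c x = linForm c v} := by
    intro x hx y hy s t hs ht hst
    simp only [Set.mem_ofPred_eq, linForm_add, linForm_smul, matApply_add, matApply_smul] at *
    rw [hx.1, hx.2, hy.1, hy.2, ← add_mul, ← add_smul, hst, one_mul, one_smul]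
    exact ⟨rfl, rfl⟩
  have hsub : K.extremePoints ℝ ∩ argminOn (linForm (tiltedCost B c u)) K ⊆
      {x | matApply B x = matApply B v ∧ linForm c x = linForm c v} := fun w hw =>
    hface w hw.1 hw.2
  have hpv := convexHull_min hsub hconv hp
  refine ⟨hpK, fun y hy => ?_⟩
  rw [factoredQuad, hpv.1, hpv.2]
  exact hvm.2 y hy

lemma finite_optVertices (hK : IsProbPolytope K) : (optVertices K B c).Finite :=
  hK.finite_extremePoints.subset fun _ h => h.1

lemma optVertices_nonempty (hK : IsProbPolytope K) (B : Matrix ρ ι ℝ) (c : EuclideanSpace ℝ ι) :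
    (optVertices K B c).Nonempty := by
  obtain ⟨v, hv, hvm⟩ := hK.exists_extremePoint_argmin_factoredQuad B c
  exact ⟨v, hK.mem_optVertices_iff.2 ⟨hv, hvm⟩⟩

/-- On the cell of a vertex `v`, `g₀` is at least the objective at `v`, and only finitely many
vertices occur. -/
lemma alphaConst_pos (hK : IsProbPolytope K) : 0 < alphaConst K B c := by
  obtain ⟨v₀, hv₀, hv₀m⟩ := hK.exists_extremePoint_argmin_factoredQuad B c
  refine (hK.finite_extremePoints.subset Set.sdiff_subset).iInf_pos fun v hv => ?_
  have hlt : factoredQuad B c v₀ < factoredQuad B c v := by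
    by_contra hle
    exact hv.2 (hK.mem_optVertices_iff.2 ⟨hv.1, hv.1.1, fun y hy =>
      (not_lt.1 hle).trans (hv₀m.2 y hy)⟩)
  refine (ENNReal.ofReal_pos.2 (sub_pos.2 hlt)).trans_le (le_iInf₂ fun u hu => ?_)
  rw [hK.iInf_gZero hv₀m, hK.gZero_eq hv.1.1 hu]
  exact ENNReal.ofReal_le_ofReal
    (sub_le_sub_right (factoredQuad_le_liftedObjective B c v u) _)

lemma gammaConst_pos (hK : IsProbPolytope K) : 0 < gammaConst K B c :=
  hK.finite_optVertices.iInf_pos fun _ hv => hK.gammaAt_pos (hK.mem_optVertices_iff.1 hv).2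

lemma lpGap_pos (hK : IsProbPolytope K) (a : EuclideanSpace ℝ ι) : 0 < lpGap K a := by
  obtain ⟨v, hv, hvm⟩ := hK.exists_extremePoint_argmin a
  refine (hK.finite_extremePoints.subset Set.sdiff_subset).iInf_pos fun w hw => ?_
  rw [ENNReal.ofReal_pos, lpValue_eq_of_mem_argmin hvm, sub_pos]
  by_contra hle
  exact hw.2 ⟨hw.1.1, fun y hy => (not_lt.1 hle).trans (hvm.2 y hy)⟩

lemma deltaConst_pos (hK : IsProbPolytope K) : 0 < deltaConst K B c := by
  refine hK.finite_optVertices.iInf_pos fun v hv => lt_min (hK.lpGap_pos _) ?_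
  have h1 := hK.gammaAt_pos (hK.mem_optVertices_iff.1 hv).2
  refine ENNReal.mul_pos (ENNReal.div_pos h1.ne' (by simp)).ne' (ne_of_gt ?_)
  refine (hK.finite_extremePoints.subset fun w hw => hw.1).iInf_pos fun w hw => ?_
  exact ENNReal.ofReal_pos.2 (norm_pos_iff.2 (sub_ne_zero.2 hw.2))

/-- If some vertex has another image under `B`, the second term of `Δ_v` is finite. If none has, the
objective is affine on `K`, and being nonconstant it has a suboptimal vertex, so `κ` is finite. -/
lemma deltaConst_ne_top (hK : IsProbPolytope K)
    (hf : ∃ x ∈ K, ∃ y ∈ K, factoredQuad B c x ≠ factoredQuad B c y) :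
    deltaConst K B c ≠ ⊤ := by
  obtain ⟨v, hv⟩ := hK.optVertices_nonempty B c
  obtain ⟨hve, hvm⟩ := hK.mem_optVertices_iff.1 hv
  refine ne_top_of_le_ne_top ?_ (iInf₂_le v hv)
  by_cases hB : ∃ w ∈ K.extremePoints ℝ, matApply B w ≠ matApply B v
  · obtain ⟨w, hw, hne⟩ := hB
    refine ne_top_of_le_ne_top (ENNReal.mul_ne_top (ENNReal.div_ne_top
      (hK.gammaAt_ne_top hvm hw hne) two_ne_zero) ?_) (min_le_right _ _)
    exact ne_top_of_le_ne_top ENNReal.ofReal_ne_top (iInf₂_le w ⟨hw, hne⟩)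
  · push Not at hB
    refine ne_top_of_le_ne_top ?_ (min_le_left _ _)
    set a := tiltedCost B c (matApply B v) with ha
    obtain ⟨w, hw, hwa⟩ : ∃ w ∈ K.extremePoints ℝ, w ∉ argminOn (linForm a) K := by
      by_contra! hall
      have hconst : ∀ x ∈ K, factoredQuad B c x = factoredQuad B c v := by
        have hconv : Convex ℝ {x | matApply B x = matApply B v ∧ linForm a x = linForm a v} := by
          intro x hx y hy s t hs ht hst
          simp only [Set.mem_ofPred_eq, linForm_add, linForm_smul, matApply_add,
            matApply_smul] at *
          rw [hx.1, hx.2, hy.1, hy.2, ← add_mul, ← add_smul, hst, one_mul, one_smul]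
          exact ⟨rfl, rfl⟩
        have hsub : K.extremePoints ℝ ⊆
            {x | matApply B x = matApply B v ∧ linForm a x = linForm a v} := fun w hw =>
          ⟨hB w hw, le_antisymm ((hall w hw).2 v hve.1) ((hall v hve).2 w hw.1)⟩
        intro x hx
        rw [← hK.convexHull_extremePoints] at hx
        have h := convexHull_min hsub hconv hx
        rw [← liftedObjective_matApply, ← liftedObjective_matApply, h.1, liftedObjective,
          liftedObjective, ← ha, h.2]
      obtain ⟨x, hx, y, hy, hne⟩ := hf
      exact hne ((hconst x hx).trans (hconst y hy).symm)
    exact ne_top_of_le_ne_top ENNReal.ofReal_ne_top (iInf₂_le w ⟨hw, hwa⟩)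

end IsProbPolytope

end Cells

/-! ### Explicit rates -/

section Rates

variable {ι ρ : Type*} [Fintype ι] [Fintype ρ] {K : Set (EuclideanSpace ℝ ι)}
  {B : Matrix ρ ι ℝ} {c : EuclideanSpace ℝ ι}

lemma inner_matApply (B : Matrix ρ ι ℝ) (x y : EuclideanSpace ℝ ι) :
    inner ℝ (matApply B x) (matApply B y) = x.ofLp ⬝ᵥ ((Bᵀ * B) *ᵥ y.ofLp) := by
  rw [EuclideanSpace.inner_eq_star_dotProduct, star_trivial, matApply, matApply,
    ← Matrix.mulVec_mulVec, Matrix.dotProduct_mulVec x.ofLp, Matrix.vecMul_transpose,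
    dotProduct_comm]

lemma inner_matApply_le (B : Matrix ρ ι ℝ) (x y : EuclideanSpace ℝ ι) :
    inner ℝ (matApply B x) (matApply B y) ≤ ‖x‖ * (opNorm (Bᵀ * B) * ‖y‖) := by
  classical
  have h : inner ℝ (matApply B x) (matApply B y) =
      inner ℝ x (Matrix.toEuclideanCLM (n := ι) (𝕜 := ℝ) (Bᵀ * B) y) := by
    rw [inner_matApply, Matrix.inner_toEuclideanCLM]
  have hop : opNorm (Bᵀ * B) = ‖Matrix.toEuclideanCLM (n := ι) (𝕜 := ℝ) (Bᵀ * B)‖ := by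
    unfold opNorm; congr!
  rw [h, hop]
  refine (real_inner_le_norm _ _).trans ?_
  gcongr
  exact ContinuousLinearMap.le_opNorm _ _

namespace IsProbPolytope

lemma norm_mix_sub_le (hK : IsProbPolytope K) {p s x : EuclideanSpace ℝ ι} (hp : p ∈ K) (hs : s ∈ K)
    {t : ℝ} (h0 : 0 ≤ t) (hx : x = (1 - t) • p + t • s) : ‖x - p‖ ≤ 2 * t := by
  have : x - p = t • (s - p) := by rw [hx]; module
  rw [this, norm_smul, Real.norm_of_nonneg h0]
  have := norm_sub_le s p
  have := hK.norm_le_one hp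
  have := hK.norm_le_one hs
  nlinarith

lemma factoredQuad_sub_le (hK : IsProbPolytope K) {p s x : EuclideanSpace ℝ ι} (hp : p ∈ K)
    (hs : s ∈ K) (hxK : x ∈ K) {t : ℝ} (h0 : 0 ≤ t) (hx : x = (1 - t) • p + t • s) :
    factoredQuad B c x - factoredQuad B c p ≤ 2 * t * (opNorm (Bᵀ * B) + ‖c‖) := by
  have hxp := hK.norm_mix_sub_le hp hs h0 hx
  -- Difference of squares: the factor `p - x` has norm at most `2t` and `p + x` at most 2.
  have h1 : factoredQuad B c x - factoredQuad B c p =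
      1 / 2 * inner ℝ (matApply B (p - x)) (matApply B (p + x)) + linForm c (x - p) := by
    simp only [factoredQuad, matApply_sub, matApply_add, linForm_sub, inner_sub_left,
      inner_add_right, real_inner_self_eq_norm_sq]
    rw [real_inner_comm (matApply B x) (matApply B p)]
    ring
  have h2 := inner_matApply_le B (p - x) (p + x)
  have h3 : linForm c (x - p) ≤ ‖c‖ * ‖x - p‖ := by
    rw [linForm_eq_inner]; exact real_inner_le_norm _ _
  have h4 : ‖p + x‖ ≤ 2 := by
    linarith [norm_add_le p x, hK.norm_le_one hp, hK.norm_le_one hxK]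
  have hM : 0 ≤ opNorm (Bᵀ * B) := norm_nonneg _
  have h5 : ‖p - x‖ * (opNorm (Bᵀ * B) * ‖p + x‖) ≤ 2 * t * (opNorm (Bᵀ * B) * 2) := by
    rw [norm_sub_rev]; gcongr
  have h6 : ‖c‖ * ‖x - p‖ ≤ ‖c‖ * (2 * t) := by gcongr
  rw [h1]
  linarith

lemma rateC2_pos (hK : IsProbPolytope K) : rateC2 K B c ≠ 0 := by
  rw [rateC2]
  exact (ENNReal.div_pos hK.deltaConst_pos.ne' ENNReal.ofReal_ne_top).ne'

lemma rateC2_ne_top (hK : IsProbPolytope K)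
    (hf : ∃ x ∈ K, ∃ y ∈ K, factoredQuad B c x ≠ factoredQuad B c y) : rateC2 K B c ≠ ⊤ := by
  rw [rateC2, hK.l1Radius_eq]
  exact ENNReal.div_ne_top (hK.deltaConst_ne_top hf) (by simp)

lemma rateC3_pos (hK : IsProbPolytope K) : rateC3 K B c ≠ 0 := by
  refine (lt_min ?_ (lt_min ?_ ?_)).ne'
  · exact ENNReal.div_pos hK.alphaConst_pos.ne' ENNReal.ofReal_ne_top
  · exact ENNReal.div_pos (pow_ne_zero 2 hK.gammaConst_pos.ne') ENNReal.ofReal_ne_top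
  · exact ENNReal.div_pos hK.deltaConst_pos.ne' ENNReal.ofReal_ne_top

lemma rateC3_ne_top (hK : IsProbPolytope K)
    (hf : ∃ x ∈ K, ∃ y ∈ K, factoredQuad B c x ≠ factoredQuad B c y) : rateC3 K B c ≠ ⊤ := by
  refine ne_top_of_le_ne_top (ENNReal.div_ne_top (hK.deltaConst_ne_top hf) ?_)
    ((min_le_right _ _).trans (min_le_right _ _))
  have := hK.entropyRadius_nonneg
  rw [hK.l1Radius_eq]
  exact (ENNReal.ofReal_pos.2 (by linarith)).ne'

/-- The exponential rates for the entropically penalized concave quadratic program. -/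
theorem entropic_rates (hK : IsProbPolytope K)
    (hf : ∃ x ∈ K, ∃ y ∈ K, factoredQuad B c x ≠ factoredQuad B c y) {ε : ℝ} (hε : 0 < ε)
    (hε' : ε ≤ (rateC3 K B c).toReal) {x : EuclideanSpace ℝ ι}
    (hx : x ∈ argminOn (fun x => factoredQuad B c x - ε * vecEntropy x) K) :
    Metric.infDist x (argminOn (factoredQuad B c) K) ≤
        rateC1 K * Real.exp (-(rateC2 K B c).toReal / ε) ∧
      ∀ y ∈ argminOn (factoredQuad B c) K, factoredQuad B c x - factoredQuad B c y ≤
        rateC1' K (Bᵀ * B) c * Real.exp (-(rateC2 K B c).toReal / ε) := by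
  have hnt : K.Nontrivial := by
    obtain ⟨x, hx, y, hy, hne⟩ := hf
    exact ⟨x, hx, y, hy, fun h => hne (h ▸ rfl)⟩
  have hR := hK.entropyRadius_nonneg
  have hΔt := hK.deltaConst_ne_top hf
  set D := (deltaConst K B c).toReal with hD
  have hD0 : 0 < D := ENNReal.toReal_pos hK.deltaConst_pos.ne' hΔt
  have hC2 : (rateC2 K B c).toReal = D / 2 := by
    rw [rateC2, hK.l1Radius_eq, ENNReal.toReal_div, ← hD]
    simp
  have hle : ENNReal.ofReal ε ≤ rateC3 K B c :=
    (ENNReal.ofReal_le_iff_le_toReal (hK.rateC3_ne_top hf)).2 hε'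
  rw [rateC3, le_min_iff, le_min_iff, hK.l1Radius_eq] at hle
  obtain ⟨hα, hγ, hΔ⟩ := hle
  have hΔ' : ε * (1 + entropyRadius K) ≤ D := by
    have := ENNReal.mul_le_of_le_div hΔ
    rwa [← ENNReal.ofReal_mul hε.le, ENNReal.ofReal_le_iff_le_toReal hΔt] at this
  obtain ⟨p, hp, s, hs, t, h0, hxt, ht⟩ := hK.exists_decomposition_quadratic hnt hε hα hγ
    ENNReal.ofReal_toReal_le hx
  set E := Real.exp (1 + entropyRadius K) with hE
  set F := Real.exp (-(D / 2) / ε) with hF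
  have hFF : Real.exp (-D / ε) = F * F := by
    rw [hF, ← Real.exp_add]; congr 1; ring
  have hF0 : 0 < F := Real.exp_pos _
  -- From `ε ≤ Δ / (1 + R_H)`, `exp(Δ / (2ε)) ≥ 1 + 1/2`. One of the two factors `F` in the bound on
  -- `t` thus absorbs the constant `3/2` needed for `C₁'`.
  have hF1 : 3 / 2 * F ≤ 1 := by
    have h1 : 1 / 2 ≤ D / 2 / ε := by
      rw [le_div_iff₀ hε]; nlinarith
    have h2 := Real.add_one_le_exp (D / 2 / ε)
    have h3 : F * Real.exp (D / 2 / ε) = 1 := by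
      rw [hF, ← Real.exp_add, neg_div, neg_add_cancel, Real.exp_zero]
    nlinarith
  have htF : 3 / 2 * t ≤ E * F := by
    rw [← hD, hFF] at ht
    have hE0 : 0 < E := Real.exp_pos _
    have : E * F * (3 / 2 * F) ≤ E * F * 1 := by gcongr
    linarith
  rw [hC2, ← hF, rateC1, rateC1', hK.l1Radius_eq, div_one, ← hE]
  constructor
  · refine (Metric.infDist_le_dist_of_mem hp).trans ?_
    rw [dist_eq_norm]
    linarith [hK.norm_mix_sub_le hp.1 hs h0 hxt]
  · intro y hy
    have h1 := hK.factoredQuad_sub_le (B := B) (c := c) hp.1 hs hx.1 h0 hxt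
    have h2 := hp.2 y hy.1
    set m := max (4 * (1 : ℝ) ^ 2 * opNorm (Bᵀ * B)) (2 * ‖c‖ * 1) with hm
    have h3 : 4 * (1 : ℝ) ^ 2 * opNorm (Bᵀ * B) ≤ m := le_max_left _ _
    have h4 : 2 * ‖c‖ * 1 ≤ m := le_max_right _ _
    have h5 : 0 ≤ m := le_trans (by positivity) h4
    -- The two norms are at most `m / 4` and `m / 2`, which sum to `3m / 4`.
    have h6 : 2 * t * (opNorm (Bᵀ * B) + ‖c‖) ≤ m * (3 / 2 * t) := by nlinarith
    have h7 := mul_le_mul_of_nonneg_left htF h5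
    linarith

end IsProbPolytope

end Rates

end

noncomputable section

/-! ### Marginals of plans on finite spaces -/

section Couplings

variable {X₀ X₁ : Type*} [MeasurableSpace X₀] [MeasurableSpace X₁]
  {μ₀ : Measure X₀} {μ₁ : Measure X₁}

lemma isProbabilityMeasure_of_mem_couplings [IsProbabilityMeasure μ₀] {π : Measure (X₀ × X₁)}
    (hπ : π ∈ couplings μ₀ μ₁) : IsProbabilityMeasure π := by
  have h : IsProbabilityMeasure (π.map Prod.fst) := by rw [hπ.1]; infer_instance
  exact Measure.isProbabilityMeasure_of_map Prod.fst

lemma map_fst_real_singleton [Fintype X₁]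
    [MeasurableSingletonClass X₀] [MeasurableSingletonClass X₁]
    (π : Measure (X₀ × X₁)) [IsFiniteMeasure π] (i : X₀) :
    (π.map Prod.fst).real {i} = ∑ j, π.real {(i, j)} := by
  rw [map_measureReal_apply measurable_fst (measurableSet_singleton i)]
  have := sum_measureReal_singleton (μ := π) ({i} ×ˢ Finset.univ)
  rw [Finset.sum_product, Finset.sum_singleton] at this
  rw [this]
  congr 1
  ext z
  simp [Prod.ext_iff, eq_comm]

lemma map_snd_real_singleton [Fintype X₀]
    [MeasurableSingletonClass X₀] [MeasurableSingletonClass X₁]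
    (π : Measure (X₀ × X₁)) [IsFiniteMeasure π] (j : X₁) :
    (π.map Prod.snd).real {j} = ∑ i, π.real {(i, j)} := by
  rw [map_measureReal_apply measurable_snd (measurableSet_singleton j)]
  have := sum_measureReal_singleton (μ := π) (Finset.univ ×ˢ {j})
  simp only [Finset.sum_product, Finset.sum_singleton] at this
  rw [this]
  congr 1
  ext z
  simp [Prod.ext_iff, eq_comm]

end Couplings

/-! ### The transport polytope and the alignment cost -/

section Transport

variable {X₀ X₁ : Type*} [Fintype X₀] [Fintype X₁] [MeasurableSpace X₀] [MeasurableSpace X₁]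
  {μ₀ : Measure X₀} {μ₁ : Measure X₁}

lemma mem_transportPolytope_iff {x : EuclideanSpace ℝ (X₀ × X₁)} :
    x ∈ transportPolytope μ₀ μ₁ ↔ (∀ i, ∑ j, x (i, j) = μ₀.real {i}) ∧
      (∀ j, ∑ i, x (i, j) = μ₁.real {j}) ∧ ∀ z, 0 ≤ x z := by
  have h1 : ∀ i, (marginalMatrix X₀ X₁ *ᵥ x.ofLp) (Sum.inl i) = ∑ j, x (i, j) := by
    intro i
    classical
    simp only [marginalMatrix, Matrix.mulVec, dotProduct, Fintype.sum_prod_type_right,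
      Matrix.of_apply, Sum.elim_inl, ite_mul, one_mul, zero_mul]
    exact Finset.sum_congr rfl fun j _ => by rw [Finset.sum_ite_eq' _ _ fun i => x (i, j)]; simp
  have h2 : ∀ j, (marginalMatrix X₀ X₁ *ᵥ x.ofLp) (Sum.inr j) = ∑ i, x (i, j) := by
    intro j
    classical
    simp only [marginalMatrix, Matrix.mulVec, dotProduct, Fintype.sum_prod_type,
      Matrix.of_apply, Sum.elim_inr, ite_mul, one_mul, zero_mul]
    exact Finset.sum_congr rfl fun i _ => by rw [Finset.sum_ite_eq' _ _ fun j => x (i, j)]; simp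
  rw [transportPolytope, Set.mem_ofPred_eq, funext_iff, Sum.forall]
  simp only [h1, h2, marginalVector, Sum.elim_inl, Sum.elim_inr, and_assoc]

lemma sum_mul_fst {x : EuclideanSpace ℝ (X₀ × X₁)} (hx : x ∈ transportPolytope μ₀ μ₁)
    (F : X₀ → ℝ) : ∑ z, x z * F z.1 = ∑ i, μ₀.real {i} * F i := by
  rw [Fintype.sum_prod_type]
  simp only [← Finset.sum_mul, (mem_transportPolytope_iff.1 hx).1]

lemma sum_mul_snd {x : EuclideanSpace ℝ (X₀ × X₁)} (hx : x ∈ transportPolytope μ₀ μ₁)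
    (F : X₁ → ℝ) : ∑ z, x z * F z.2 = ∑ j, μ₁.real {j} * F j := by
  rw [Fintype.sum_prod_type_right]
  simp only [← Finset.sum_mul, (mem_transportPolytope_iff.1 hx).2.1]

lemma sum_measureReal_singleton_eq_one {X : Type*} [Fintype X] [MeasurableSpace X]
    [MeasurableSingletonClass X] (μ : Measure X) [IsProbabilityMeasure μ] :
    ∑ i, μ.real {i} = 1 := by
  rw [sum_measureReal_singleton, Finset.coe_univ, probReal_univ]

/-- The vector of point masses of a plan. -/
def planVec (π : Measure (X₀ × X₁)) : EuclideanSpace ℝ (X₀ × X₁) :=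
  WithLp.toLp 2 fun z => π.real {z}

lemma vecEntropy_planVec (π : Measure (X₀ × X₁)) : vecEntropy (planVec π) = planEntropy π := rfl

/-- When `w` is supported in the support of `v`, the segment from `w` to `v` can be prolonged beyond
`v` inside the polytope; extremality then forces `w = v`. -/
lemma eq_of_support_of_mem_extremePoints {v w : EuclideanSpace ℝ (X₀ × X₁)}
    (hv : v ∈ (transportPolytope μ₀ μ₁).extremePoints ℝ) (hw : w ∈ transportPolytope μ₀ μ₁)
    (h : ∀ z, v z = 0 → w z = 0) : w = v := by
  obtain ⟨hv1, hv2, hv3⟩ := mem_transportPolytope_iff.1 hv.1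
  obtain ⟨hw1, hw2, hw3⟩ := mem_transportPolytope_iff.1 hw
  have hev : ∀ᶠ t : ℝ in nhdsWithin 0 (Set.Ioi 0), ∀ z, t * w z ≤ v z := by
    rw [Filter.eventually_all]
    intro z
    rcases (hv3 z).eq_or_lt with hz | hz
    · exact Filter.Eventually.of_forall fun t => by rw [h z hz.symm, ← hz, mul_zero]
    · have hc : Filter.Tendsto (fun t : ℝ => t * w z) (nhds 0) (nhds 0) := by
        have : Continuous fun t : ℝ => t * w z := by fun_prop
        simpa using this.tendsto 0
      exact (hc.eventually_le_const hz).filter_mono nhdsWithin_le_nhds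
  obtain ⟨t, ht, ht0⟩ := (hev.and self_mem_nhdsWithin).exists
  replace ht0 : 0 < t := ht0
  have hy : v + t • (v - w) ∈ transportPolytope μ₀ μ₁ := by
    rw [mem_transportPolytope_iff]
    simp only [PiLp.add_apply, PiLp.smul_apply, PiLp.sub_apply, smul_eq_mul,
      Finset.sum_add_distrib, ← Finset.mul_sum, Finset.sum_sub_distrib, hv1, hv2, hw1, hw2,
      sub_self, mul_zero, add_zero, implies_true, true_and]
    intro z
    nlinarith [ht z, hv3 z]
  refine ((mem_extremePoints.1 hv).2 w hw _ hy ⟨t / (1 + t), 1 / (1 + t), by positivity,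
    by positivity, by field_simp; ring, ?_⟩).1
  rw [smul_add, smul_smul, smul_sub]
  have h1 : 1 / (1 + t) * t = t / (1 + t) := by ring
  have h2 : t / (1 + t) = 1 - 1 / (1 + t) := by field_simp; ring
  rw [h1, h2]
  module

variable [MeasurableSingletonClass X₀]

lemma sum_eq_one_of_mem_transportPolytope [IsProbabilityMeasure μ₀]
    {x : EuclideanSpace ℝ (X₀ × X₁)} (hx : x ∈ transportPolytope μ₀ μ₁) : ∑ z, x z = 1 := by
  simpa [sum_measureReal_singleton_eq_one] using sum_mul_fst hx fun _ => 1

variable [MeasurableSingletonClass X₁]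

lemma isProbPolytope_transportPolytope (μ₀ : Measure X₀) (μ₁ : Measure X₁)
    [IsProbabilityMeasure μ₀] [IsProbabilityMeasure μ₁] :
    IsProbPolytope (transportPolytope μ₀ μ₁) where
  convex := by
    intro x hx y hy s t hs ht hst
    rw [mem_transportPolytope_iff] at *
    simp only [PiLp.add_apply, PiLp.smul_apply, smul_eq_mul, Finset.sum_add_distrib,
      ← Finset.mul_sum, hx.1, hx.2.1, hy.1, hy.2.1, ← add_mul, hst, one_mul, implies_true,
      true_and]
    intro z
    have := hx.2.2 z
    have := hy.2.2 z
    positivity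
  compact := by
    refine Metric.isCompact_of_isClosed_isBounded ?_ ?_
    · have : transportPolytope μ₀ μ₁ = {x | marginalMatrix X₀ X₁ *ᵥ x.ofLp = marginalVector μ₀ μ₁} ∩
          ⋂ z, {x | 0 ≤ x z} := by
        ext x; simp [transportPolytope]
      rw [this]
      refine (isClosed_eq (by fun_prop) continuous_const).inter (isClosed_iInter fun z => ?_)
      exact isClosed_le continuous_const (by fun_prop)
    · refine (Metric.isBounded_closedBall (x := 0) (r := 1)).subset fun x hx => ?_
      rw [mem_closedBall_zero_iff]
      exact norm_le_one_of_sum_eq_one hx.2 (sum_eq_one_of_mem_transportPolytope hx)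
  nonempty := by
    refine ⟨WithLp.toLp 2 fun z => μ₀.real {z.1} * μ₁.real {z.2}, ?_⟩
    rw [mem_transportPolytope_iff]
    simp only [← Finset.mul_sum, ← Finset.sum_mul, sum_measureReal_singleton_eq_one, mul_one,
      one_mul, implies_true, true_and]
    intro z
    positivity
  nonneg x hx := hx.2
  sum_eq_one x hx := sum_eq_one_of_mem_transportPolytope hx
  eq_of_support v hv w hw h := eq_of_support_of_mem_extremePoints hv hw h

lemma planVec_mem [IsProbabilityMeasure μ₀] {π : Measure (X₀ × X₁)}
    (hπ : π ∈ couplings μ₀ μ₁) : planVec π ∈ transportPolytope μ₀ μ₁ := by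
  have := isProbabilityMeasure_of_mem_couplings hπ
  rw [mem_transportPolytope_iff]
  refine ⟨fun i => ?_, fun j => ?_, fun z => measureReal_nonneg⟩
  · rw [← hπ.1, map_fst_real_singleton]; rfl
  · rw [← hπ.2, map_snd_real_singleton]; rfl

lemma exists_planVec_eq [IsProbabilityMeasure μ₀] [IsProbabilityMeasure μ₁]
    {x : EuclideanSpace ℝ (X₀ × X₁)} (hx : x ∈ transportPolytope μ₀ μ₁) :
    ∃ π ∈ couplings μ₀ μ₁, planVec π = x := by
  classical
  obtain ⟨h1, h2, h3⟩ := mem_transportPolytope_iff.1 hx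
  set π : Measure (X₀ × X₁) := ∑ z, ENNReal.ofReal (x z) • Measure.dirac z with hπ
  have hs : ∀ z, π {z} = ENNReal.ofReal (x z) := by
    intro z
    simp [hπ, Measure.finsetSum_apply, Set.indicator_apply]
  have hfin : IsFiniteMeasure π := by
    refine ⟨?_⟩
    simp [hπ, Measure.finsetSum_apply, ENNReal.sum_lt_top]
  have hr : ∀ z, π.real {z} = x z := fun z => by
    rw [measureReal_def, hs, ENNReal.toReal_ofReal (h3 z)]
  refine ⟨π, ⟨?_, ?_⟩, ?_⟩
  · refine Measure.ext_of_singleton fun i => ?_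
    rw [← measureReal_eq_measureReal_iff, map_fst_real_singleton]
    simp only [hr, h1]
  · refine Measure.ext_of_singleton fun j => ?_
    rw [← measureReal_eq_measureReal_iff, map_snd_real_singleton]
    simp only [hr, h2]
  · ext z; exact hr z

lemma concaveQuad_eq_sum {ι : Type*} [Fintype ι] (M : Matrix ι ι ℝ) (x : EuclideanSpace ℝ ι) :
    concaveQuad M x = -(1 / 2) * ∑ z, ∑ z', x z * x z' * M z z' := by
  simp only [concaveQuad, dotProduct, Matrix.mulVec, Finset.mul_sum]
  exact Finset.sum_congr rfl fun z _ => Finset.sum_congr rfl fun z' _ => by ring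

lemma gwCost_eq_sum (k₀ : X₀ → X₀ → ℝ) (k₁ : X₁ → X₁ → ℝ) (q : ℕ) (π : Measure (X₀ × X₁))
    [IsFiniteMeasure π] :
    gwCost k₀ k₁ 2 q π = ∑ z, ∑ z', planVec π z * planVec π z' *
      (k₀ z.1 z'.1 ^ q - k₁ z.2 z'.2 ^ q) ^ 2 := by
  rw [gwCost, integral_fintype Integrable.of_finite]
  refine Finset.sum_congr rfl fun z _ => ?_
  rw [integral_fintype Integrable.of_finite, smul_eq_mul, Finset.mul_sum]
  refine Finset.sum_congr rfl fun z' _ => ?_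
  rw [smul_eq_mul, Real.rpow_two, sq_abs, mul_assoc]
  rfl

/-- The alignment cost is the concave quadratic objective up to a constant that only depends on
the marginals. -/
lemma exists_gwCost_eq (μ₀ : Measure X₀) (μ₁ : Measure X₁) [IsProbabilityMeasure μ₀]
    (k₀ : X₀ → X₀ → ℝ) (k₁ : X₁ → X₁ → ℝ) (q : ℕ) :
    ∃ C : ℝ, ∀ π ∈ couplings μ₀ μ₁,
      gwCost k₀ k₁ 2 q π = concaveQuad (gwMatrix k₀ k₁ q) (planVec π) + C := by
  -- Expanding the square, the pure terms see only the marginals, and the cross term `-2` is `-½ ·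
  -- 4`.
  refine ⟨∑ i, μ₀.real {i} * ∑ i', μ₀.real {i'} * (k₀ i i' ^ q) ^ 2 +
    ∑ j, μ₁.real {j} * ∑ j', μ₁.real {j'} * (k₁ j j' ^ q) ^ 2, fun π hπ => ?_⟩
  have := isProbabilityMeasure_of_mem_couplings hπ
  have hx := planVec_mem hπ
  rw [gwCost_eq_sum, concaveQuad_eq_sum]
  set x := planVec π
  have h0 : ∑ z, ∑ z', x z * x z' * (k₀ z.1 z'.1 ^ q) ^ 2 =
      ∑ i, μ₀.real {i} * ∑ i', μ₀.real {i'} * (k₀ i i' ^ q) ^ 2 := by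
    rw [← sum_mul_fst hx fun i => ∑ i', μ₀.real {i'} * (k₀ i i' ^ q) ^ 2]
    refine Finset.sum_congr rfl fun z _ => ?_
    rw [← sum_mul_fst hx fun i' => (k₀ z.1 i' ^ q) ^ 2, Finset.mul_sum]
    exact Finset.sum_congr rfl fun z' _ => mul_assoc _ _ _
  have h1 : ∑ z, ∑ z', x z * x z' * (k₁ z.2 z'.2 ^ q) ^ 2 =
      ∑ j, μ₁.real {j} * ∑ j', μ₁.real {j'} * (k₁ j j' ^ q) ^ 2 := by
    rw [← sum_mul_snd hx fun j => ∑ j', μ₁.real {j'} * (k₁ j j' ^ q) ^ 2]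
    refine Finset.sum_congr rfl fun z _ => ?_
    rw [← sum_mul_snd hx fun j' => (k₁ z.2 j' ^ q) ^ 2, Finset.mul_sum]
    exact Finset.sum_congr rfl fun z' _ => mul_assoc _ _ _
  rw [← h0, ← h1, Finset.mul_sum, ← Finset.sum_add_distrib, ← Finset.sum_add_distrib]
  refine Finset.sum_congr rfl fun z _ => ?_
  rw [Finset.mul_sum, ← Finset.sum_add_distrib, ← Finset.sum_add_distrib]
  refine Finset.sum_congr rfl fun z' _ => ?_
  simp only [gwMatrix, Matrix.smul_apply, Matrix.kroneckerMap_apply, Matrix.of_apply, smul_eq_mul]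
  ring

end Transport

/-! ### Squared Euclidean distances after centring -/

section Euclidean

/-- Terms with exactly one of `P`, `Q` vanish on summing over the variable absent from `A` or `B`;
symmetry puts that variable in the second slot. -/
lemma sum_centred_mul {Z : Type*} [Fintype Z] (w A B : Z → ℝ) (P Q : Z → Z → ℝ)
    (hw : ∑ z, w z = 1) (hP : ∀ z, ∑ z', w z' * P z z' = 0)
    (hQ : ∀ z, ∑ z', w z' * Q z z' = 0) (hPs : ∀ z z', P z z' = P z' z)
    (hQs : ∀ z z', Q z z' = Q z' z) :
    ∑ z, ∑ z', w z * w z' * ((A z + A z' - 2 * P z z') * (B z + B z' - 2 * Q z z')) =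
      2 * ∑ z, w z * (A z * B z) + 2 * ((∑ z, w z * A z) * ∑ z, w z * B z) +
        4 * ∑ z, ∑ z', w z * w z' * (P z z' * Q z z') := by
  have prod : ∀ f g : Z → ℝ, ∑ z, ∑ z', f z * g z' = (∑ z, f z) * ∑ z, g z :=
    fun f g => (Finset.sum_mul_sum _ _ _ _).symm
  have left : ∀ (f : Z → ℝ) (R : Z → Z → ℝ), (∀ z, ∑ z', w z' * R z z' = 0) →
      ∑ z, ∑ z', f z * (w z' * R z z') = 0 := fun f R hR => by
    simp only [← Finset.mul_sum, hR, mul_zero, Finset.sum_const_zero]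
  have right : ∀ (f : Z → ℝ) (R : Z → Z → ℝ), (∀ z, ∑ z', w z' * R z z' = 0) →
      ∑ z, ∑ z', f z' * (w z * R z' z) = 0 := fun f R hR => by
    rw [Finset.sum_comm]; exact left f R hR
  have key : ∀ z z', w z * w z' * ((A z + A z' - 2 * P z z') * (B z + B z' - 2 * Q z z')) =
      (w z * (A z * B z)) * w z' + w z * (w z' * (A z' * B z')) +
      (w z * A z) * (w z' * B z') + (w z * B z) * (w z' * A z') +
      4 * (w z * w z' * (P z z' * Q z z')) -
      2 * ((w z * A z) * (w z' * Q z z')) - 2 * ((w z' * A z') * (w z * Q z' z)) -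
      2 * ((w z * B z) * (w z' * P z z')) - 2 * ((w z' * B z') * (w z * P z' z)) := by
    intro z z'
    rw [hPs z' z, hQs z' z]
    ring
  have const : ∀ (r : ℝ) (F : Z → Z → ℝ), ∑ z, ∑ z', r * F z z' = r * ∑ z, ∑ z', F z z' :=
    fun r F => by simp only [Finset.mul_sum]
  simp only [key, Finset.sum_add_distrib, Finset.sum_sub_distrib, const,
    prod (fun z => w z * (A z * B z)) w, prod w (fun z => w z * (A z * B z)),
    prod (fun z => w z * A z) (fun z => w z * B z), prod (fun z => w z * B z) (fun z => w z * A z),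
    left (fun z => w z * A z) Q hQ, right (fun z => w z * A z) Q hQ,
    left (fun z => w z * B z) P hP, right (fun z => w z * B z) P hP, hw]
  ring

lemma sum_inner_centred {X : Type*} [Fintype X] [MeasurableSpace X] [MeasurableSingletonClass X]
    (μ : Measure X) [IsProbabilityMeasure μ] {d : ℕ} (ξ : X → EuclideanSpace ℝ (Fin d))
    (a : EuclideanSpace ℝ (Fin d)) : ∑ i, μ.real {i} * inner ℝ a (centred μ ξ i) = 0 := by
  have h : ∑ i, μ.real {i} • centred μ ξ i = 0 := by
    simp only [centred, smul_sub, Finset.sum_sub_distrib, ← Finset.sum_smul,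
      sum_measureReal_singleton_eq_one, one_smul]
    rw [integral_fintype Integrable.of_finite, sub_self]
  simp only [← real_inner_smul_right, ← inner_sum, h, inner_zero_right]

lemma euclideanFactor_gram {X₀ X₁ : Type*} {d₀ d₁ : ℕ} (a : X₀ → EuclideanSpace ℝ (Fin d₀))
    (b : X₁ → EuclideanSpace ℝ (Fin d₁)) (z z' : X₀ × X₁) :
    ((euclideanFactor a b)ᵀ * euclideanFactor a b) z z' =
      16 * (inner ℝ (a z.1) (a z'.1) * inner ℝ (b z.2) (b z'.2)) := by
  simp only [Matrix.mul_apply, Matrix.transpose_apply, euclideanFactor, Matrix.of_apply,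
    EuclideanSpace.inner_eq_star_dotProduct, star_trivial, dotProduct, Finset.sum_mul_sum,
    Fintype.sum_prod_type]
  simp only [Finset.mul_sum]
  exact Finset.sum_congr rfl fun i _ => Finset.sum_congr rfl fun j _ => by ring

variable {X₀ X₁ : Type*} [Fintype X₀] [Fintype X₁]
  [MeasurableSpace X₀] [MeasurableSpace X₁]
  [MeasurableSingletonClass X₀] [MeasurableSingletonClass X₁]

lemma exists_concaveQuad_euclidean (μ₀ : Measure X₀) (μ₁ : Measure X₁) [IsProbabilityMeasure μ₀]
    [IsProbabilityMeasure μ₁] {k₀ : X₀ → X₀ → ℝ} {k₁ : X₁ → X₁ → ℝ} {d₀ d₁ : ℕ}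
    {ξ₀ : X₀ → EuclideanSpace ℝ (Fin d₀)} {ξ₁ : X₁ → EuclideanSpace ℝ (Fin d₁)}
    (hk₀ : ∀ x x', k₀ x x' = ‖ξ₀ x - ξ₀ x'‖) (hk₁ : ∀ y y', k₁ y y' = ‖ξ₁ y - ξ₁ y'‖) :
    ∃ C : ℝ, ∀ x ∈ transportPolytope μ₀ μ₁, concaveQuad (gwMatrix k₀ k₁ 2) x =
      concaveQuad ((euclideanFactor (centred μ₀ ξ₀) (centred μ₁ ξ₁))ᵀ *
          euclideanFactor (centred μ₀ ξ₀) (centred μ₁ ξ₁)) x +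
        linForm (euclideanLinear (centred μ₀ ξ₀) (centred μ₁ ξ₁)) x + C := by
  set a := centred μ₀ ξ₀ with ha
  set b := centred μ₁ ξ₁ with hb
  -- The product of the two weighted sums of squared norms depends on the marginals alone.
  refine ⟨-4 * ((∑ i, μ₀.real {i} * ‖a i‖ ^ 2) * ∑ j, μ₁.real {j} * ‖b j‖ ^ 2), fun x hx => ?_⟩
  have hdiff₀ : ∀ i i', k₀ i i' ^ 2 = ‖a i‖ ^ 2 + ‖a i'‖ ^ 2 - 2 * inner ℝ (a i) (a i') := by
    intro i i'
    have : ξ₀ i - ξ₀ i' = a i - a i' := by simp [ha, centred]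
    rw [hk₀, this, norm_sub_sq_real]; ring
  have hdiff₁ : ∀ j j', k₁ j j' ^ 2 = ‖b j‖ ^ 2 + ‖b j'‖ ^ 2 - 2 * inner ℝ (b j) (b j') := by
    intro j j'
    have : ξ₁ j - ξ₁ j' = b j - b j' := by simp [hb, centred]
    rw [hk₁, this, norm_sub_sq_real]; ring
  have hP : ∀ z : X₀ × X₁, ∑ z', x z' * inner ℝ (a z.1) (a z'.1) = 0 := fun z => by
    rw [sum_mul_fst hx fun i => inner ℝ (a z.1) (a i)]; exact sum_inner_centred μ₀ ξ₀ _
  have hQ : ∀ z : X₀ × X₁, ∑ z', x z' * inner ℝ (b z.2) (b z'.2) = 0 := fun z => by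
    rw [sum_mul_snd hx fun j => inner ℝ (b z.2) (b j)]; exact sum_inner_centred μ₁ ξ₁ _
  have key := sum_centred_mul (fun z => x z) (fun z => ‖a z.1‖ ^ 2) (fun z => ‖b z.2‖ ^ 2)
    (fun z z' => inner ℝ (a z.1) (a z'.1)) (fun z z' => inner ℝ (b z.2) (b z'.2))
    (sum_eq_one_of_mem_transportPolytope hx) hP hQ (fun _ _ => real_inner_comm _ _)
    (fun _ _ => real_inner_comm _ _)
  rw [sum_mul_fst hx fun i => ‖a i‖ ^ 2, sum_mul_snd hx fun j => ‖b j‖ ^ 2] at key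
  have h1 : concaveQuad (gwMatrix k₀ k₁ 2) x = -2 * ∑ z : X₀ × X₁, ∑ z' : X₀ × X₁, x z * x z' *
      ((‖a z.1‖ ^ 2 + ‖a z'.1‖ ^ 2 - 2 * inner ℝ (a z.1) (a z'.1)) *
        (‖b z.2‖ ^ 2 + ‖b z'.2‖ ^ 2 - 2 * inner ℝ (b z.2) (b z'.2))) := by
    rw [concaveQuad_eq_sum]
    simp only [Finset.mul_sum]
    refine Finset.sum_congr rfl fun z _ => Finset.sum_congr rfl fun z' _ => ?_
    simp only [gwMatrix, Matrix.smul_apply, Matrix.kroneckerMap_apply, Matrix.of_apply,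
      smul_eq_mul, hdiff₀, hdiff₁]
    ring
  have h2 : concaveQuad ((euclideanFactor a b)ᵀ * euclideanFactor a b) x =
      -8 * ∑ z : X₀ × X₁, ∑ z' : X₀ × X₁, x z * x z' *
        (inner ℝ (a z.1) (a z'.1) * inner ℝ (b z.2) (b z'.2)) := by
    rw [concaveQuad_eq_sum]
    simp only [Finset.mul_sum, euclideanFactor_gram]
    exact Finset.sum_congr rfl fun z _ => Finset.sum_congr rfl fun z' _ => by ring
  have h3 : linForm (euclideanLinear a b) x =
      -4 * ∑ z : X₀ × X₁, x z * (‖a z.1‖ ^ 2 * ‖b z.2‖ ^ 2) := by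
    simp only [linForm, euclideanLinear, dotProduct, Finset.mul_sum]
    exact Finset.sum_congr rfl fun z _ => by ring
  rw [h1, h2, h3, key]
  ring

end Euclidean

/-! ### Positive semidefiniteness and factorization -/

section Factorization

/-- Schur product theorem, iterated. -/
lemma Matrix.PosSemidef.map_pow {ι : Type*} {A : Matrix ι ι ℝ} (hA : A.PosSemidef) {q : ℕ}
    (hq : 0 < q) : (Matrix.of fun i j => A i j ^ q).PosSemidef := by
  induction q, hq using Nat.le_induction with
  | base => convert hA using 1; ext; simp
  | succ q _ ih =>
    have : (Matrix.of fun i j => A i j ^ (q + 1)) = (Matrix.of fun i j => A i j ^ q).hadamard A := by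
      ext; simp [pow_succ]
    rw [this]
    exact ih.hadamard hA

/-- The signs cancel in the product of kernels, which reduces the negative semidefinite case to the
positive one. -/
lemma gwMatrix_neg {X₀ X₁ : Type*} (k₀ : X₀ → X₀ → ℝ) (k₁ : X₁ → X₁ → ℝ) (q : ℕ) :
    gwMatrix (fun x y => -k₀ x y) (fun x y => -k₁ x y) q = gwMatrix k₀ k₁ q := by
  ext z z'
  simp only [gwMatrix, Matrix.smul_apply, Matrix.kroneckerMap_apply, Matrix.of_apply, smul_eq_mul,
    ← mul_pow, neg_mul_neg]

lemma IsPSDKernel.posSemidef {X : Type*} [Fintype X] {k : X → X → ℝ} (hk : IsPSDKernel k) :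
    (Matrix.of k).PosSemidef := by
  have h := (hk _ (Fintype.equivFin X).symm).submatrix (Fintype.equivFin X)
  convert h using 1
  ext; simp

lemma IsNSDKernel.isPSDKernel_neg {X : Type*} {k : X → X → ℝ} (hk : IsNSDKernel k) :
    IsPSDKernel fun x y => -k x y := fun s x => hk s x

variable {X₀ X₁ : Type*} [Fintype X₀] [Fintype X₁] {k₀ : X₀ → X₀ → ℝ} {k₁ : X₁ → X₁ → ℝ}

lemma posSemidef_gwMatrix (h₀ : IsPSDKernel k₀) (h₁ : IsPSDKernel k₁) {q : ℕ} (hq : 0 < q) :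
    (gwMatrix k₀ k₁ q).PosSemidef :=
  ((h₀.posSemidef.map_pow hq).kronecker (h₁.posSemidef.map_pow hq)).smul (by norm_num)

lemma Matrix.PosSemidef.exists_eq_transpose_mul {ι : Type*} [Fintype ι] {M : Matrix ι ι ℝ}
    (hM : M.PosSemidef) : ∃ B : Matrix (Fin (Fintype.card ι)) ι ℝ, M = Bᵀ * B := by
  classical
  open scoped MatrixOrder in
  obtain ⟨B, hB⟩ := CStarAlgebra.nonneg_iff_eq_star_mul_self.mp hM.nonneg
  refine ⟨B.submatrix (Fintype.equivFin ι).symm id, ?_⟩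
  rw [Matrix.transpose_submatrix, Matrix.submatrix_mul_equiv, hB, Matrix.submatrix_id_id,
    Matrix.star_eq_conjTranspose, Matrix.conjTranspose_eq_transpose_of_trivial]

end Factorization

end

/-! ### Transfer to couplings and conclusion -/

section Objectives

lemma argminOn_congr_add_const {E : Type*} {f g : E → ℝ} {K : Set E} {C : ℝ}
    (h : ∀ x ∈ K, f x = g x + C) : argminOn f K = argminOn g K := by
  ext x
  refine and_congr_right fun hx => forall₂_congr fun y hy => ?_
  rw [h x hx, h y hy, add_le_add_iff_right]

lemma factoredQuad_eq_concaveQuad {ι ρ : Type*} [Fintype ι] [Fintype ρ] (B : Matrix ρ ι ℝ)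
    (c x : EuclideanSpace ℝ ι) :
    factoredQuad B c x = concaveQuad (Bᵀ * B) x + linForm c x := by
  rw [factoredQuad, concaveQuad, ← inner_matApply, real_inner_self_eq_norm_sq]

variable {X₀ X₁ : Type*} [MeasurableSpace X₀] [MeasurableSpace X₁]

lemma gwDist_two_sq (k₀ : X₀ → X₀ → ℝ) (k₁ : X₁ → X₁ → ℝ) (q : ℕ) (μ₀ : Measure X₀)
    (μ₁ : Measure X₁) :
    gwDist k₀ k₁ 2 q μ₀ μ₁ ^ 2 = sInf (gwCost k₀ k₁ 2 q '' couplings μ₀ μ₁) := by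
  rw [gwDist, ← Real.sqrt_eq_rpow, Real.sq_sqrt]
  refine Real.sInf_nonneg ?_
  rintro _ ⟨π, -, rfl⟩
  exact integral_nonneg fun z => integral_nonneg fun z' => Real.rpow_nonneg (abs_nonneg _) _

end Objectives

theorem corollary2
    {X₀ X₁ : Type*} [Fintype X₀] [Fintype X₁]
    [MeasurableSpace X₀] [MeasurableSpace X₁]
    [MeasurableSingletonClass X₀] [MeasurableSingletonClass X₁]
    (μ₀ : Measure X₀) (μ₁ : Measure X₁) [IsProbabilityMeasure μ₀] [IsProbabilityMeasure μ₁]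
    (k₀ : X₀ → X₀ → ℝ) (k₁ : X₁ → X₁ → ℝ) (q : ℕ)
    (M : Matrix (X₀ × X₁) (X₀ × X₁) ℝ) (c : EuclideanSpace ℝ (X₀ × X₁))
    (h :
      -- both kernels PSD or both NSD
      (((IsPSDKernel k₀ ∧ IsPSDKernel k₁) ∨ (IsNSDKernel k₀ ∧ IsNSDKernel k₁)) ∧ 0 < q ∧
        M = gwMatrix k₀ k₁ q ∧ c = 0) ∨
      -- Euclidean distances and `q = 2`
      (∃ (d₀ d₁ : ℕ) (ξ₀ : X₀ → EuclideanSpace ℝ (Fin d₀)) (ξ₁ : X₁ → EuclideanSpace ℝ (Fin d₁)),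
        (∀ x x', k₀ x x' = ‖ξ₀ x - ξ₀ x'‖) ∧ (∀ y y', k₁ y y' = ‖ξ₁ y - ξ₁ y'‖) ∧ q = 2 ∧
        M = (euclideanFactor (centred μ₀ ξ₀) (centred μ₁ ξ₁))ᵀ *
          euclideanFactor (centred μ₀ ξ₀) (centred μ₁ ξ₁) ∧
        c = euclideanLinear (centred μ₀ ξ₀) (centred μ₁ ξ₁))) :
    (∃ r ≤ Fintype.card X₀ * Fintype.card X₁, ∃ B : Matrix (Fin r) (X₀ × X₁) ℝ, M = Bᵀ * B) ∧
    ∀ (r : ℕ) (B : Matrix (Fin r) (X₀ × X₁) ℝ), M = Bᵀ * B →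
      ∃ C₂ C₃ : ℝ, 0 < C₂ ∧ 0 < C₃ ∧
        -- the explicit values, whenever the objective is not constant on the feasible set
        ((∃ x ∈ transportPolytope μ₀ μ₁, ∃ y ∈ transportPolytope μ₀ μ₁,
            concaveQuad (gwMatrix k₀ k₁ q) x ≠ concaveQuad (gwMatrix k₀ k₁ q) y) →
          ENNReal.ofReal C₂ = rateC2 (transportPolytope μ₀ μ₁) B c ∧
          ENNReal.ofReal C₃ = rateC3 (transportPolytope μ₀ μ₁) B c) ∧
        (argminOn (concaveQuad (gwMatrix k₀ k₁ q)) (transportPolytope μ₀ μ₁)).Nonempty ∧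
        (∀ ε : ℝ, 0 < ε → ε ≤ C₃ →
          ∀ x ∈ argminOn (fun x => concaveQuad (gwMatrix k₀ k₁ q) x - ε * vecEntropy x)
              (transportPolytope μ₀ μ₁),
            Metric.infDist x
                (argminOn (concaveQuad (gwMatrix k₀ k₁ q)) (transportPolytope μ₀ μ₁)) ≤
              rateC1 (transportPolytope μ₀ μ₁) * Real.exp (-C₂ / ε)) ∧
        (∀ ε : ℝ, 0 < ε → ε ≤ C₃ →
          ∀ π : Measure (X₀ × X₁), IsEGWSolution k₀ k₁ q μ₀ μ₁ ε π →
            0 ≤ gwCost k₀ k₁ 2 q π - gwDist k₀ k₁ 2 q μ₀ μ₁ ^ 2 ∧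
            gwCost k₀ k₁ 2 q π - gwDist k₀ k₁ 2 q μ₀ μ₁ ^ 2 ≤
              rateC1' (transportPolytope μ₀ μ₁) M c * Real.exp (-C₂ / ε)) := by
  have hK := isProbPolytope_transportPolytope μ₀ μ₁
  set K := transportPolytope μ₀ μ₁
  set f := concaveQuad (gwMatrix k₀ k₁ q)
  refine ⟨?_, fun r B hB => ?_⟩
  · have hM : M.PosSemidef := by
      rcases h with ⟨⟨h₀, h₁⟩ | ⟨h₀, h₁⟩, hq, rfl, -⟩ | ⟨d₀, d₁, ξ₀, ξ₁, -, -, -, rfl, -⟩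
      · exact posSemidef_gwMatrix h₀ h₁ hq
      · rw [← gwMatrix_neg]
        exact posSemidef_gwMatrix h₀.isPSDKernel_neg h₁.isPSDKernel_neg hq
      · have := Matrix.posSemidef_conjTranspose_mul_self
          (euclideanFactor (centred μ₀ ξ₀) (centred μ₁ ξ₁))
        rwa [Matrix.conjTranspose_eq_transpose_of_trivial] at this
    obtain ⟨B, hB⟩ := hM.exists_eq_transpose_mul
    rw [← Fintype.card_prod]
    exact ⟨_, le_rfl, B, hB⟩
  · obtain ⟨C, hC⟩ : ∃ C : ℝ, ∀ x ∈ K, f x = factoredQuad B c x + C := by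
      rcases h with ⟨-, -, rfl, rfl⟩ | ⟨d₀, d₁, ξ₀, ξ₁, hk₀, hk₁, rfl, rfl, rfl⟩
      · refine ⟨0, fun x _ => ?_⟩
        rw [factoredQuad_eq_concaveQuad, ← hB, linForm_eq_inner, inner_zero_left, add_zero,
          add_zero]
      · obtain ⟨C, hC⟩ := exists_concaveQuad_euclidean μ₀ μ₁ hk₀ hk₁
        refine ⟨C, fun x hx => ?_⟩
        rw [factoredQuad_eq_concaveQuad, ← hB]
        exact hC x hx
    obtain ⟨C', hC'⟩ := exists_gwCost_eq μ₀ μ₁ k₀ k₁ q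
    have harg : argminOn f K = argminOn (factoredQuad B c) K := argminOn_congr_add_const hC
    have hargε : ∀ ε : ℝ, argminOn (fun x => f x - ε * vecEntropy x) K =
        argminOn (fun x => factoredQuad B c x - ε * vecEntropy x) K := fun ε =>
      argminOn_congr_add_const (C := C) fun x hx => by rw [hC x hx]; ring
    obtain ⟨v, -, hv⟩ := hK.exists_extremePoint_argmin_factoredQuad B c
    -- The infimum is attained by the coupling whose vector is the optimal vertex `v`.
    have hgw : gwDist k₀ k₁ 2 q μ₀ μ₁ ^ 2 = factoredQuad B c v + C + C' := by
      obtain ⟨π₀, hπ₀, hπv⟩ := exists_planVec_eq hv.1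
      rw [gwDist_two_sq]
      refine IsLeast.csInf_eq ⟨⟨π₀, hπ₀, ?_⟩, ?_⟩
      · rw [hC' π₀ hπ₀, hπv, ← hC v hv.1]
      · rintro _ ⟨π, hπ, rfl⟩
        rw [hC' π hπ]
        have h1 := hC _ (planVec_mem hπ)
        have h2 := hv.2 _ (planVec_mem hπ)
        linarith
    have hcost : ∀ π ∈ couplings μ₀ μ₁, gwCost k₀ k₁ 2 q π - gwDist k₀ k₁ 2 q μ₀ μ₁ ^ 2 =
        factoredQuad B c (planVec π) - factoredQuad B c v := fun π hπ => by
      have h1 := hC _ (planVec_mem hπ)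
      have h2 := hC' π hπ
      linarith
    have hsol : ∀ (ε : ℝ) (π : Measure (X₀ × X₁)), IsEGWSolution k₀ k₁ q μ₀ μ₁ ε π →
        planVec π ∈ argminOn (fun x => factoredQuad B c x - ε * vecEntropy x) K := by
      rintro ε π ⟨hπ, hmin⟩
      rw [← hargε]
      refine ⟨planVec_mem hπ, fun y hy => ?_⟩
      obtain ⟨π', hπ', rfl⟩ := exists_planVec_eq hy
      have h1 := hmin π' hπ'
      rw [hC' π hπ, hC' π' hπ'] at h1
      simp only [vecEntropy_planVec]
      linarith
    have hnonneg : ∀ π ∈ couplings μ₀ μ₁,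
        0 ≤ gwCost k₀ k₁ 2 q π - gwDist k₀ k₁ 2 q μ₀ μ₁ ^ 2 := fun π hπ => by
      rw [hcost π hπ]
      exact sub_nonneg.2 (hv.2 _ (planVec_mem hπ))
    rw [harg]
    by_cases hf : ∃ x ∈ K, ∃ y ∈ K, f x ≠ f y
    · have hf' : ∃ x ∈ K, ∃ y ∈ K, factoredQuad B c x ≠ factoredQuad B c y := by
        obtain ⟨x, hx, y, hy, hne⟩ := hf
        exact ⟨x, hx, y, hy, fun h => hne (by rw [hC x hx, hC y hy, h])⟩
      refine ⟨(rateC2 K B c).toReal, (rateC3 K B c).toReal,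
        ENNReal.toReal_pos hK.rateC2_pos (hK.rateC2_ne_top hf'),
        ENNReal.toReal_pos hK.rateC3_pos (hK.rateC3_ne_top hf'),
        fun _ => ⟨ENNReal.ofReal_toReal (hK.rateC2_ne_top hf'),
          ENNReal.ofReal_toReal (hK.rateC3_ne_top hf')⟩, ⟨v, hv⟩, ?_, ?_⟩
      · intro ε hε hε' x hx
        rw [hargε] at hx
        exact (hK.entropic_rates hf' hε hε' hx).1
      · intro ε hε hε' π hπ
        refine ⟨hnonneg π hπ.1, ?_⟩
        rw [hcost π hπ.1, hB]
        exact (hK.entropic_rates hf' hε hε' (hsol ε π hπ)).2 v hv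
    · have hconst : ∀ x ∈ K, ∀ y ∈ K, factoredQuad B c x = factoredQuad B c y := by
        intro x hx y hy
        push Not at hf
        have := hf x hx y hy
        rw [hC x hx, hC y hy] at this
        linarith
      -- With a constant objective every feasible point is optimal and both errors vanish, so any
      -- positive constants do.
      refine ⟨1, 1, one_pos, one_pos, fun h => absurd h hf, ⟨v, hv⟩, ?_, ?_⟩
      · intro ε _ _ x hx
        have hxm : x ∈ argminOn (factoredQuad B c) K := ⟨hx.1, fun y hy => (hconst x hx.1 y hy).le⟩
        rw [Metric.infDist_zero_of_mem hxm, rateC1, hK.l1Radius_eq]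
        positivity
      · intro ε _ _ π hπ
        refine ⟨hnonneg π hπ.1, ?_⟩
        rw [hcost π hπ.1, hconst _ (planVec_mem hπ.1) v hv.1, sub_self, rateC1', hK.l1Radius_eq]
        have : 0 ≤ max (4 * (1 : ℝ) ^ 2 * opNorm M) (2 * ‖c‖ * 1) :=
          le_max_of_le_right (by positivity)
        positivity
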